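/- Let $\mathcal O_2$ be the ring of germs at the origin of holomorphic functions $\mathbb C^2\to\mathbb C$, and let $f\in\mathcal O_2$ satisfy $f(0)=0$ and have no repeated factors in $\mathcal O_2$ (equivalently, $f$ has at most an isolated singularity at $0$). The components of the curve germ $C_f=\{f=0\}$ are the germs $\{p=0\}$, $p$ an irreducible factor of $f$ in $\mathcal O_2$; such a component is smooth if $dp(0)\neq 0$. Let $\mathcal I(f)$ be the set of all orders of vanishing $\operatorname{ord}_0(f\circ\alpha)\in\mathbb N\cup\{\infty\}$, where $\alpha$ ranges over all germs of holomorphic immersions $(\mathbb C,0)\to(\mathbb C^2,0)$. For $g\in\mathcal O_2$ put $m(f,g)=\dim_{\mathbb C}\mathcal O_2/\langle f,g\rangle\in\mathbb N\cup\{\infty\}$, and set $I_f=m(f,i_f)$, $V_f=m(f,v_f)$, where $$i_f=f_y^2f_{xx}-2f_xf_yf_{xy}+f_x^2f_{yy},$$ $$v_f=(f_x^2+f_y^2)\left(f_x^3f_{yyy}-3f_x^2f_yf_{xyy}+3f_xf_y^2f_{xxy}-f_y^3f_{xxx}\right)-3\left((f_x^2-f_y^2)f_{xy}-f_xf_y(f_{xx}-f_{yy})\right)i_f.$$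 If $f$ has no smooth components, then $\mathcal I(f)$ is a finite set of natural numbers (in particular $f\circ\alpha\not\equiv0$ for every immersion germ $\alpha$), and both $I_f$ and $V_f$ are finite. -/

import Mathlib

open Filter Topology

namespace PlaneCurve

noncomputable section

/-- Germs at the origin form a `ℂ`-algebra under pointwise operations. -/
instance germAlgebra : Algebra ℂ (Germ (𝓝 (0 : ℂ × ℂ)) ℂ) :=
  Algebra.ofModule
    (fun c φ ψ => Germ.inductionOn₂ φ ψ fun F G =>
      congrArg (fun H : ℂ × ℂ → ℂ => (H : Germ (𝓝 (0 : ℂ × ℂ)) ℂ)) (smul_mul_assoc c F G))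
    (fun c φ ψ => Germ.inductionOn₂ φ ψ fun F G =>
      congrArg (fun H : ℂ × ℂ → ℂ => (H : Germ (𝓝 (0 : ℂ × ℂ)) ℂ)) (mul_smul_comm c F G))

/-- The `ℂ`-algebra `𝒪₂` of germs at the origin of holomorphic functions `ℂ² → ℂ`. -/
def O2 : Subalgebra ℂ (Germ (𝓝 (0 : ℂ × ℂ)) ℂ) where
  carrier := {φ | ∃ F : ℂ × ℂ → ℂ, AnalyticAt ℂ F 0 ∧ (F : Germ (𝓝 (0 : ℂ × ℂ)) ℂ) = φ}
  mul_mem' := by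
    rintro _ _ ⟨F, hF, rfl⟩ ⟨G, hG, rfl⟩
    exact ⟨F * G, hF.mul hG, rfl⟩
  add_mem' := by
    rintro _ _ ⟨F, hF, rfl⟩ ⟨G, hG, rfl⟩
    exact ⟨F + G, hF.add hG, rfl⟩
  algebraMap_mem' := fun c => ⟨c • (1 : ℂ × ℂ → ℂ), (analyticAt_const : AnalyticAt ℂ (fun _ => c • (1 : ℂ)) _), rfl⟩

/-- The directional derivative, in the direction `v`, of a germ at the origin of `ℂ²`. -/
def germDeriv (v : ℂ × ℂ) :
    Germ (𝓝 (0 : ℂ × ℂ)) ℂ → Germ (𝓝 (0 : ℂ × ℂ)) ℂ :=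
  Germ.map' (fun F p => fderiv ℂ F p v) (by
    intro F G h
    filter_upwards [EventuallyEq.fderiv (𝕜 := ℂ) h] with p hp
    rw [hp])

theorem germDeriv_mem (v : ℂ × ℂ) {φ : Germ (𝓝 (0 : ℂ × ℂ)) ℂ} (h : φ ∈ O2) :
    germDeriv v φ ∈ O2 := by
  obtain ⟨F, hF, rfl⟩ := h
  exact ⟨fun p => fderiv ℂ F p v,
    (ContinuousLinearMap.analyticAt (ContinuousLinearMap.apply ℂ ℂ v) _).comp hF.fderiv, rfl⟩

/-- The partial derivative `∂f/∂x` of a holomorphic germ. -/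
def dx (f : O2) : O2 := ⟨germDeriv (1, 0) f, germDeriv_mem _ f.2⟩

/-- The partial derivative `∂f/∂y` of a holomorphic germ. -/
def dy (f : O2) : O2 := ⟨germDeriv (0, 1) f, germDeriv_mem _ f.2⟩

/-- The value `f(0)` of a holomorphic germ at the origin. -/
def value (f : O2) : ℂ := Germ.value (f : Germ (𝓝 (0 : ℂ × ℂ)) ℂ)

/-- The differential of `f` at the origin is nonzero. For an irreducible `f` vanishing at the
origin this says that the curve germ `C_f` is smooth. -/
def IsSubmersion (f : O2) : Prop := value (dx f) ≠ 0 ∨ value (dy f) ≠ 0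

/-- No component of `f = 0` is smooth; the components are the zero germs of the irreducible
factors of `f` in `𝒪₂`. -/
def NoSmoothComponents (f : O2) : Prop :=
  ∀ p : O2, Irreducible p → p ∣ f → ¬ IsSubmersion p

/-- The order at `0` of a germ of a function of one complex variable (`⊤` for the zero germ). -/
def ord : Germ (𝓝 (0 : ℂ)) ℂ → ℕ∞ := fun φ =>
  Germ.liftOn φ (fun r => analyticOrderAt r 0) (fun _ _ h => analyticOrderAt_congr h)

/-- Germs of immersions `(ℂ, 0) → (ℂ², 0)` (given by representatives). -/
structure Immersion where
  toFun : ℂ → ℂ × ℂ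
  analyticAt : AnalyticAt ℂ toFun 0
  map_zero : toFun 0 = 0
  deriv_ne_zero : deriv toFun 0 ≠ 0

theorem Immersion.tendsto (α : Immersion) : Tendsto α.toFun (𝓝 0) (𝓝 0) := by
  simpa [α.map_zero] using α.analyticAt.continuousAt.tendsto

/-- The germ `f ∘ α`, for an immersion germ `α`. -/
def pullback (f : O2) (α : Immersion) : Germ (𝓝 (0 : ℂ)) ℂ :=
  Germ.compTendsto (f : Germ (𝓝 (0 : ℂ × ℂ)) ℂ) α.toFun α.tendsto

/-- The contact set: all orders of `f ∘ α`, where `α` ranges over the germs of immersions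
`(ℂ, 0) → (ℂ², 0)`. The value `⊤` occurs exactly if some `f ∘ α` vanishes identically. -/
def contactSet (f : O2) : Set ℕ∞ := Set.range fun α : Immersion => ord (pullback f α)

/-- The intersection number `m(f, g) = dim_ℂ 𝒪₂ / ⟨f, g⟩` in `ℕ ∪ {∞}`. -/
def intersectionNumber (f g : O2) : ℕ∞ :=
  Cardinal.toENat (Module.rank ℂ (O2 ⧸ Ideal.span ({f, g} : Set O2)))

/-- `i_f = f_y² f_xx - 2 f_x f_y f_xy + f_x² f_yy`. -/
def inflectionGerm (f : O2) : O2 :=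
  dy f ^ 2 * dx (dx f) - 2 * dx f * dy f * dy (dx f) + dx f ^ 2 * dy (dy f)

/-- The germ `v_f`, whose zeros on the smooth part of `C_f` are the vertices. -/
def vertexGerm (f : O2) : O2 :=
  (dx f ^ 2 + dy f ^ 2) *
      (dx f ^ 3 * dy (dy (dy f)) - 3 * dx f ^ 2 * dy f * dy (dy (dx f))
        + 3 * dx f * dy f ^ 2 * dy (dx (dx f)) - dy f ^ 3 * dx (dx (dx f)))
    - 3 * ((dx f ^ 2 - dy f ^ 2) * dy (dx f) - dx f * dy f * (dx (dx f) - dy (dy f))) *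
      (dy f ^ 2 * dx (dx f) - 2 * dx f * dy f * dy (dx f) + dx f ^ 2 * dy (dy f))

/-- `I_f = m(f, i_f)`, the number of inflections of `C_f` concentrated at the origin. -/
def inflectionNumber (f : O2) : ℕ∞ := intersectionNumber f (inflectionGerm f)

/-- `V_f = m(f, v_f)`, the number of vertices of `C_f` concentrated at the origin. -/
def vertexNumber (f : O2) : ℕ∞ := intersectionNumber f (vertexGerm f)

end

end PlaneCurve

/-! Both finiteness statements follow from a study of the prime ideals `P` of 𝒪₂ that contain `f`
but not both coordinates. Weierstrass division shows that such a `P` is generated by some `p ∣ f`,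
necessarily a non-smooth component, and that 𝒪₂/P is finite over the germs in `x`
(`exists_generator`, `exists_component`).

The derivation D = f_y ∂x − f_x ∂y is tangent to every component, so it acts on 𝒪₂/P. Write ' for D.
It plays the role of d/dt for a parametrisation, with velocity (x', y') = (f_y, −f_x), and its
constants in the fraction field of 𝒪₂/P are the complex numbers (`exists_const`). Up to sign, i_f is
the Wronskian x'y'' − y'x''. If it vanishes on the component, then y'/x' is constant and the
component lies on a line. Similarly v_f is the numerator of the derivative of the curvature. If it
vanishes on the component, then the curvature and its centre are constant and the component lies on
a circle. Lines and circles are smooth, so neither case occurs. Hence every prime containing `f` and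
i_f (or v_f) contains x and y, the ideal contains a power of ⟨x, y⟩, and the quotient is
finite-dimensional (`intersectionNumber_ne_top`).

For the contact orders, the same study of primes gives x^k ∈ ⟨f, f_y⟩ and y^l ∈ ⟨f, f_x⟩. If
ord(f∘α) exceeded 2 max(k, l), a Newton correction (`exists_correction`) would deform α into an
immersed curve inside f = 0, which is impossible (`not_eventually_eq_zero`). So the contact orders
are bounded, hence finite in number. -/

namespace PlaneCurve

noncomputable section

open scoped BoundedContinuousFunction

/-! ### Power series as bounded arrays, evaluated through resolvents of shifts -/

/-- Bounded arrays of complex numbers, thought of as coefficients of power series in `x`, `y`. -/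
abbrev Arr : Type := (ℕ × ℕ) →ᵇ ℂ

namespace Arr

/-- Bounded operator on arrays given by a bounded rule on coefficients. -/
def mkOp (φ : (ℕ × ℕ → ℂ) →ₗ[ℂ] (ℕ × ℕ → ℂ))
    (h : ∀ (a : Arr) n, ‖φ a n‖ ≤ ‖a‖) : Arr →L[ℂ] Arr :=
  LinearMap.mkContinuous
    { toFun := fun a => BoundedContinuousFunction.ofNormedAddCommGroupDiscrete (φ a) ‖a‖ (h a)
      map_add' := fun a b => by
        ext n
        simp [BoundedContinuousFunction.coe_add]
      map_smul' := fun c a => by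
        ext n
        exact congrFun (φ.map_smul c a) n } 1
    (fun a => by
      rw [one_mul]
      exact (BoundedContinuousFunction.norm_le (norm_nonneg _)).2 (h a))

theorem norm_mkOp_le (φ : (ℕ × ℕ → ℂ) →ₗ[ℂ] (ℕ × ℕ → ℂ))
    (h : ∀ (a : Arr) n, ‖φ a n‖ ≤ ‖a‖) : ‖mkOp φ h‖ ≤ 1 :=
  LinearMap.mkContinuous_norm_le _ zero_le_one _

/-- Backward shift in the first index. -/
def backX : Arr →L[ℂ] Arr :=
  mkOp (LinearMap.funLeft ℂ ℂ fun n => (n.1 + 1, n.2)) fun a _ => a.norm_coe_le_norm _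

/-- Backward shift in the second index. -/
def backY : Arr →L[ℂ] Arr :=
  mkOp (LinearMap.funLeft ℂ ℂ fun n => (n.1, n.2 + 1)) fun a _ => a.norm_coe_le_norm _

/-- Forward shift in the first index: multiplication by `x`. -/
def mulX : Arr →L[ℂ] Arr :=
  mkOp
    { toFun := fun a n => if n.1 = 0 then 0 else a (n.1 - 1, n.2)
      map_add' := fun a b => by ext n; dsimp; split_ifs <;> simp
      map_smul' := fun c a => by ext n; dsimp; split_ifs <;> simp }
    fun a n => by
      dsimp
      split_ifs
      · simp
      · exact a.norm_coe_le_norm _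

/-- Forward shift in the second index: multiplication by `y`. -/
def mulY : Arr →L[ℂ] Arr :=
  mkOp
    { toFun := fun a n => if n.2 = 0 then 0 else a (n.1, n.2 - 1)
      map_add' := fun a b => by ext n; dsimp; split_ifs <;> simp
      map_smul' := fun c a => by ext n; dsimp; split_ifs <;> simp }
    fun a n => by
      dsimp
      split_ifs
      · simp
      · exact a.norm_coe_le_norm _

@[simp] theorem backX_apply (a : Arr) (n : ℕ × ℕ) : backX a n = a (n.1 + 1, n.2) := rfl
@[simp] theorem backY_apply (a : Arr) (n : ℕ × ℕ) : backY a n = a (n.1, n.2 + 1) := rfl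
@[simp] theorem mulX_apply (a : Arr) (n : ℕ × ℕ) :
    mulX a n = if n.1 = 0 then 0 else a (n.1 - 1, n.2) := rfl
@[simp] theorem mulY_apply (a : Arr) (n : ℕ × ℕ) :
    mulY a n = if n.2 = 0 then 0 else a (n.1, n.2 - 1) := rfl

theorem norm_backX_le : ‖backX‖ ≤ 1 := norm_mkOp_le _ _
theorem norm_backY_le : ‖backY‖ ≤ 1 := norm_mkOp_le _ _
theorem norm_mulX_le : ‖mulX‖ ≤ 1 := norm_mkOp_le _ _
theorem norm_mulY_le : ‖mulY‖ ≤ 1 := norm_mkOp_le _ _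

theorem backX_mul_mulX : backX * mulX = 1 := by ext a n; simp
theorem backY_mul_mulY : backY * mulY = 1 := by ext a n; simp
theorem commute_backX_backY : Commute backX backY := by
  ext a n; simp
theorem commute_mulX_backY : Commute mulX backY := by
  ext a n; simp
theorem commute_mulY_backX : Commute mulY backX := by
  ext a n; simp

/-- The array of the constant function `1`. -/
def one : Arr :=
  BoundedContinuousFunction.ofNormedAddCommGroupDiscrete (Pi.single (0, 0) 1) 1 (fun n => by
    by_cases h : n = (0, 0)
    · subst h; simp
    · simp [Pi.single_eq_of_ne h])

@[simp] theorem backX_one : backX one = 0 := by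
  ext n
  exact Pi.single_eq_of_ne (M := fun _ : ℕ × ℕ => ℂ) (i := (0, 0)) (i' := (n.1 + 1, n.2))
    (by simp) 1

@[simp] theorem backY_one : backY one = 0 := by
  ext n
  exact Pi.single_eq_of_ne (M := fun _ : ℕ × ℕ => ℂ) (i := (0, 0)) (i' := (n.1, n.2 + 1))
    (by simp) 1

@[simp] theorem one_apply_zero : one (0, 0) = 1 := Pi.single_eq_same (M := fun _ : ℕ × ℕ => ℂ) (0, 0) 1

/-- The constant coefficient. -/
def coeffZero : Arr →L[ℂ] ℂ :=
  LinearMap.mkContinuous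
    { toFun := fun a => a (0, 0), map_add' := fun _ _ => rfl, map_smul' := fun _ _ => rfl } 1
    (fun a => by rw [one_mul]; exact a.norm_coe_le_norm _)

@[simp] theorem coeffZero_apply (a : Arr) : coeffZero a = a (0, 0) := rfl

/-- The resolvent summing power series in `x`. -/
def resX (x : ℂ) : Arr →L[ℂ] Arr := Ring.inverse (1 - x • backX)

/-- The resolvent summing power series in `y`. -/
def resY (y : ℂ) : Arr →L[ℂ] Arr := Ring.inverse (1 - y • backY)

theorem isUnit_one_sub_smul {T : Arr →L[ℂ] Arr} (hT : ‖T‖ ≤ 1) {x : ℂ} (hx : ‖x‖ < 1) :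
    IsUnit (1 - x • T) := by
  have key : ‖x • T‖ < 1 → IsUnit (1 - x • T) :=
    isUnit_one_sub_of_norm_lt_one (R := Arr →L[ℂ] Arr) (x := x • T)
  apply key
  rw [norm_smul]
  nlinarith [norm_nonneg x, norm_nonneg T]

theorem resX_mul_cancel {x : ℂ} (hx : ‖x‖ < 1) : resX x * (1 - x • backX) = 1 :=
  Ring.inverse_mul_cancel _ (isUnit_one_sub_smul norm_backX_le hx)

theorem resY_mul_cancel {y : ℂ} (hy : ‖y‖ < 1) : resY y * (1 - y • backY) = 1 :=
  Ring.inverse_mul_cancel _ (isUnit_one_sub_smul norm_backY_le hy)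

theorem mul_resX_cancel {x : ℂ} (hx : ‖x‖ < 1) : (1 - x • backX) * resX x = 1 :=
  Ring.mul_inverse_cancel _ (isUnit_one_sub_smul norm_backX_le hx)

theorem mul_resY_cancel {y : ℂ} (hy : ‖y‖ < 1) : (1 - y • backY) * resY y = 1 :=
  Ring.mul_inverse_cancel _ (isUnit_one_sub_smul norm_backY_le hy)

/-- The resolvent stands for ∑ xⁿ `backX`ⁿ. Its values are computed by exhibiting a solution `b` of
the equation (1 − x `backX`) b = a instead of by rearranging series. -/
theorem resX_apply_of_eq {x : ℂ} (hx : ‖x‖ < 1) {a b : Arr} (h : b - x • backX b = a) :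
    resX x a = b := by
  rw [← h]
  have := congrArg (fun T : Arr →L[ℂ] Arr => T b) (resX_mul_cancel hx)
  simpa using this

theorem resY_apply_of_eq {y : ℂ} (hy : ‖y‖ < 1) {a b : Arr} (h : b - y • backY b = a) :
    resY y a = b := by
  rw [← h]
  have := congrArg (fun T : Arr →L[ℂ] Arr => T b) (resY_mul_cancel hy)
  simpa using this

theorem resX_sub {x : ℂ} (hx : ‖x‖ < 1) (a : Arr) : resX x a - x • backX (resX x a) = a := by
  have := congrArg (fun T : Arr →L[ℂ] Arr => T a) (mul_resX_cancel hx)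
  simpa using this

theorem resY_sub {y : ℂ} (hy : ‖y‖ < 1) (a : Arr) : resY y a - y • backY (resY y a) = a := by
  have := congrArg (fun T : Arr →L[ℂ] Arr => T a) (mul_resY_cancel hy)
  simpa using this

theorem commute_resX {T : Arr →L[ℂ] Arr} (h : Commute T backX) {x : ℂ} (hx : ‖x‖ < 1)
    (a : Arr) : resX x (T a) = T (resX x a) := by
  refine resX_apply_of_eq hx ?_
  have := congrArg (fun S : Arr →L[ℂ] Arr => S (resX x a)) h.eq
  change T (backX _) = backX (T _) at this
  rw [← this, ← map_smul, ← map_sub, resX_sub hx]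

theorem commute_resY {T : Arr →L[ℂ] Arr} (h : Commute T backY) {y : ℂ} (hy : ‖y‖ < 1)
    (a : Arr) : resY y (T a) = T (resY y a) := by
  refine resY_apply_of_eq hy ?_
  have := congrArg (fun S : Arr →L[ℂ] Arr => S (resY y a)) h.eq
  change T (backY _) = backY (T _) at this
  rw [← this, ← map_smul, ← map_sub, resY_sub hy]

/-- The value at `(x, y)` of the power series with coefficients `a`. -/
def ev (z : ℂ × ℂ) (a : Arr) : ℂ := coeffZero (resX z.1 (resY z.2 a))

theorem ev_add (z : ℂ × ℂ) (a b : Arr) : ev z (a + b) = ev z a + ev z b := by simp [ev]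
theorem ev_sub (z : ℂ × ℂ) (a b : Arr) : ev z (a - b) = ev z a - ev z b := by simp [ev]
theorem ev_smul (z : ℂ × ℂ) (c : ℂ) (a : Arr) : ev z (c • a) = c * ev z a := by simp [ev]
theorem ev_zero (z : ℂ × ℂ) : ev z 0 = 0 := by simp [ev]

/-- `ev z` as a continuous functional. -/
def evL (z : ℂ × ℂ) : Arr →L[ℂ] ℂ := coeffZero.comp ((resX z.1).comp (resY z.2))

theorem evL_apply (z : ℂ × ℂ) (a : Arr) : evL z a = ev z a := rfl

variable {z : ℂ × ℂ}

theorem ev_one (hx : ‖z.1‖ < 1) (hy : ‖z.2‖ < 1) : ev z one = 1 := by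
  rw [ev, resY_apply_of_eq hy (b := one) (by simp), resX_apply_of_eq hx (b := one) (by simp)]
  simp

theorem ev_mulX (hx : ‖z.1‖ < 1) (hy : ‖z.2‖ < 1) (a : Arr) : ev z (mulX a) = z.1 * ev z a := by
  rw [ev, ev, commute_resY commute_mulX_backY hy]
  set c := resY z.2 a
  -- Since `backX` undoes `mulX`, applying 1 − x `backX` to this witness gives x c + (`mulX` c − x
  -- c). The constant coefficient of `mulX` c is 0, which leaves x times the value of c.
  rw [resX_apply_of_eq hx (b := z.1 • resX z.1 c + mulX c)]
  · simp
  · have h1 : backX (mulX c) = c := congrArg (fun T : Arr →L[ℂ] Arr => T c) backX_mul_mulX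
    rw [map_add, map_smul, h1]
    rw [← sub_eq_zero]
    have h3 := congrArg (z.1 • ·) (resX_sub hx c)
    simp only [smul_sub] at h3
    rw [smul_add, ← h3]
    abel

theorem ev_mulY (hx : ‖z.1‖ < 1) (hy : ‖z.2‖ < 1) (a : Arr) : ev z (mulY a) = z.2 * ev z a := by
  rw [ev, ev, resY_apply_of_eq hy (a := mulY a) (b := z.2 • resY z.2 a + mulY a)]
  · rw [map_add, map_smul, commute_resX commute_mulY_backX hx]
    simp
  · have h1 : backY (mulY a) = a := congrArg (fun T : Arr →L[ℂ] Arr => T a) backY_mul_mulY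
    have h3 := congrArg (z.2 • ·) (resY_sub hy a)
    simp only [smul_sub] at h3
    rw [map_add, map_smul, h1, smul_add, ← h3]
    abel

theorem ev_origin (a : Arr) : ev (0, 0) a = a (0, 0) := by
  rw [ev, resY_apply_of_eq (by simp) (b := a) (by simp), resX_apply_of_eq (by simp) (b := a) (by simp)]
  simp

/-- Inversion is analytic near 1 in the Banach algebra of operators, so both resolvents depend
analytically on the point. -/
theorem analyticAt_ev (a : Arr) : AnalyticAt ℂ (fun z => ev z a) 0 := by
  have hR (T : Arr →L[ℂ] Arr) : AnalyticAt ℂ (fun x : ℂ => Ring.inverse (1 - x • T)) 0 := by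
    have h := analyticAt_inverse_one_sub ℂ (Arr →L[ℂ] Arr)
    have h2 : AnalyticAt ℂ (fun x : ℂ => x • T) 0 := by fun_prop
    exact AnalyticAt.comp_of_eq (g := fun S : Arr →L[ℂ] Arr => Ring.inverse (1 - S)) h h2 (zero_smul ℂ T)
  have hx : AnalyticAt ℂ (fun z : ℂ × ℂ => resX z.1) 0 :=
    AnalyticAt.comp_of_eq (g := resX) (f := Prod.fst) (hR backX) analyticAt_fst rfl
  have hy : AnalyticAt ℂ (fun z : ℂ × ℂ => resY z.2) 0 :=
    AnalyticAt.comp_of_eq (g := resY) (f := Prod.snd) (hR backY) analyticAt_snd rfl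
  have happ {G : ℂ × ℂ → Arr →L[ℂ] Arr} {v : ℂ × ℂ → Arr} (hG : AnalyticAt ℂ G 0)
      (hv : AnalyticAt ℂ v 0) : AnalyticAt ℂ (fun z => G z (v z)) 0 := by
    have h0 : AnalyticAt ℂ (fun q : (Arr →L[ℂ] Arr) × Arr => q.1 q.2) (G 0, v 0) :=
      ContinuousLinearMap.analyticAt_bilinear (𝕜 := ℂ) (E := Arr →L[ℂ] Arr) (F := Arr) (G := Arr)
        (ContinuousLinearMap.id ℂ (Arr →L[ℂ] Arr)) _
    exact h0.comp_of_eq (f := fun z => (G z, v z)) (hG.prod hv) rfl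
  have h := happ hx (happ hy (analyticAt_const (v := a)))
  exact (coeffZero.analyticAt _).comp h

/-- An array without `y` evaluates to a function of `x`. -/
theorem ev_of_backY_eq_zero {a : Arr} (h : backY a = 0) (hy : ‖z.2‖ < 1) :
    ev z a = ev (z.1, 0) a := by
  rw [ev, ev, resY_apply_of_eq hy (b := a) (by simp [h]),
    resY_apply_of_eq (y := (z.1, (0 : ℂ)).2) (by simp) (b := a) (by simp)]

/-- An array without `x` evaluates to a function of `y`. -/
theorem ev_of_backX_eq_zero {a : Arr} (h : backX a = 0) (hx : ‖z.1‖ < 1) (hy : ‖z.2‖ < 1) :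
    ev z a = ev (0, z.2) a := by
  have h1 : backX (resY z.2 a) = 0 := by
    rw [← commute_resY commute_backX_backY hy, h, map_zero]
  rw [ev, ev, resX_apply_of_eq hx (b := resY z.2 a) (by simp [h1]),
    resX_apply_of_eq (x := ((0 : ℂ), z.2).1) (by simp) (b := resY z.2 a) (by simp)]

end Arr

/-! ### Multiplication by an analytic function as a bounded operator -/

namespace Arr

instance : Nontrivial Arr :=
  ⟨one, 0, fun h => one_ne_zero (α := ℂ) (by simpa using congrArg (fun a : Arr => a (0, 0)) h)⟩

theorem ev_pow_mul_pow {z : ℂ × ℂ} (hx : ‖z.1‖ < 1) (hy : ‖z.2‖ < 1) (r s : ℂ) (m n : ℕ)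
    (q : Arr) : ev z (((r • mulX) ^ m * (s • mulY) ^ n) q)
      = (r * z.1) ^ m * (s * z.2) ^ n * ev z q := by
  have h1 : ∀ m (a : Arr), ev z (((r • mulX) ^ m) a) = (r * z.1) ^ m * ev z a := by
    intro m
    induction m with
    | zero => intro a; simp
    | succ m ih =>
      intro a
      rw [pow_succ]
      change ev z (((r • mulX) ^ m) (r • mulX a)) = _
      rw [ih, ev_smul, ev_mulX hx hy]
      ring
  have h2 : ∀ m (a : Arr), ev z (((s • mulY) ^ m) a) = (s * z.2) ^ m * ev z a := by
    intro m
    induction m with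
    | zero => intro a; simp
    | succ m ih =>
      intro a
      rw [pow_succ]
      change ev z (((s • mulY) ^ m) (s • mulY a)) = _
      rw [ih, ev_smul, ev_mulY hx hy]
      ring
  change ev z (((r • mulX) ^ m) (((s • mulY) ^ n) q)) = _
  rw [h1, h2, mul_assoc]

theorem norm_pow_mul_pow_le {r s ρ : ℝ} (hr : 0 ≤ r) (hrρ : r ≤ ρ) (hs : 0 ≤ s) (hsρ : s ≤ ρ)
    {m n : ℕ} (h : m ≤ n) :
    ‖(((r : ℂ) • mulX) ^ m * ((s : ℂ) • mulY) ^ (n - m) : Arr →L[ℂ] Arr)‖ ≤ ρ ^ n := by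
  have hρ : 0 ≤ ρ := hr.trans hrρ
  have h1 : ‖((r : ℂ) • mulX : Arr →L[ℂ] Arr)‖ ≤ ρ := by
    rw [norm_smul, Complex.norm_real, Real.norm_of_nonneg hr]
    nlinarith [norm_mulX_le, norm_nonneg mulX]
  have h2 : ‖((s : ℂ) • mulY : Arr →L[ℂ] Arr)‖ ≤ ρ := by
    rw [norm_smul, Complex.norm_real, Real.norm_of_nonneg hs]
    nlinarith [norm_mulY_le, norm_nonneg mulY]
  calc _ ≤ ‖(((r : ℂ) • mulX) ^ m : Arr →L[ℂ] Arr)‖ * ‖(((s : ℂ) • mulY) ^ (n - m) : Arr →L[ℂ] Arr)‖ :=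
        norm_mul_le _ _
    _ ≤ ρ ^ m * ρ ^ (n - m) := by
        gcongr
        · exact (norm_pow_le _ _).trans (pow_le_pow_left₀ (norm_nonneg _) h1 _)
        · exact (norm_pow_le _ _).trans (pow_le_pow_left₀ (norm_nonneg _) h2 _)
    _ = ρ ^ n := by rw [← pow_add, Nat.add_sub_cancel' h]

/-- Writing (x, y) = (x, 0) + (0, y) and expanding by multilinearity gives one term for each set σ
of slots that receive the first summand. -/
theorem multilinear_diag_eq_sum {n : ℕ}
    (p : ContinuousMultilinearMap ℂ (fun _ : Fin n => ℂ × ℂ) ℂ) (x y : ℂ) :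
    p (fun _ => (x, y)) = ∑ σ : Finset (Fin n),
      p (σ.piecewise (fun _ => (1, 0)) (fun _ => (0, 1))) * (x ^ σ.card * y ^ (n - σ.card)) := by
  have h1 : (fun _ : Fin n => (x, y)) = (fun _ => (x, (0 : ℂ))) + fun _ => ((0 : ℂ), y) := by
    ext <;> simp
  rw [h1, p.map_add_univ]
  refine Finset.sum_congr rfl fun σ _ => ?_
  have h2 : (σ.piecewise (fun _ : Fin n => (x, (0 : ℂ))) fun _ => ((0 : ℂ), y)) =
      fun i => (if i ∈ σ then x else y) •
        (σ.piecewise (fun _ : Fin n => ((1 : ℂ), (0 : ℂ))) fun _ => ((0 : ℂ), (1 : ℂ))) i := by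
    ext i <;> by_cases hi : i ∈ σ <;> simp [hi]
  rw [h2, p.map_smul_univ, smul_eq_mul, mul_comm]
  congr 1
  rw [Finset.prod_ite]
  simp only [Finset.prod_const]
  congr 2
  · congr 1; ext; simp
  · have h := Finset.card_compl σ
    rw [Fintype.card_fin] at h
    rw [← h]
    congr 1; ext; simp

/-- Multiplication by a rescaled analytic function acts on bounded arrays. -/
theorem exists_mulOp {w : ℂ × ℂ → ℂ} (hw : AnalyticAt ℂ w 0) :
    ∃ ρ : ℝ, 0 < ρ ∧ ∃ C : ℝ, 0 ≤ C ∧ ∀ r s : ℝ, 0 ≤ r → r ≤ ρ → 0 ≤ s → s ≤ ρ →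
      ∃ W : Arr →L[ℂ] Arr, ‖W‖ ≤ C ∧ ∀ z : ℂ × ℂ, ‖z.1‖ < 1 → ‖z.2‖ < 1 → ∀ q,
        ev z (W q) = w (r * z.1, s * z.2) * ev z q := by
  obtain ⟨p, R, hp⟩ := hw
  obtain ⟨ρ₂, hρ₂0, hρ₂⟩ := ENNReal.lt_iff_exists_nnreal_btwn.1 hp.r_pos
  have hρ0 : 0 < ρ₂ := by exact_mod_cast hρ₂0
  have hsum := p.summable_norm_mul_pow (hρ₂.trans_le hp.r_le)
  -- Half the radius compensates for the 2ⁿ subsets in the expansion of the n-th term. The constant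
  -- does not depend on r and s, so these can be shrunk later with the bound kept.
  refine ⟨ρ₂ / 2, by positivity, ∑' n, ‖p n‖ * (ρ₂ : ℝ) ^ n, tsum_nonneg fun n => by positivity,
    fun r s hr hrρ hs hsρ => ?_⟩
  set c : ∀ n, Finset (Fin n) → ℂ := fun n σ =>
    p n (σ.piecewise (fun _ => (1, 0)) (fun _ => (0, 1))) with hc
  have hcn : ∀ n σ, ‖c n σ‖ ≤ ‖p n‖ := by
    intro n σ
    refine ((p n).le_opNorm _).trans ?_
    refine mul_le_of_le_one_right (norm_nonneg _) (Finset.prod_le_one (fun _ _ => norm_nonneg _) ?_)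
    intro i _
    by_cases hi : i ∈ σ <;> simp [hi, Prod.norm_def]
  set T : ℕ → Arr →L[ℂ] Arr := fun n => ∑ σ : Finset (Fin n),
    c n σ • (((r : ℂ) • mulX) ^ σ.card * ((s : ℂ) • mulY) ^ (n - σ.card)) with hT
  have hTn : ∀ n, ‖T n‖ ≤ ‖p n‖ * (ρ₂ : ℝ) ^ n := by
    intro n
    calc ‖T n‖ ≤ ∑ σ : Finset (Fin n), ‖p n‖ * ((ρ₂ : ℝ) / 2) ^ n := by
          refine (norm_sum_le _ _).trans (Finset.sum_le_sum fun σ _ => ?_)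
          rw [norm_smul]
          exact mul_le_mul (hcn n σ) (norm_pow_mul_pow_le hr hrρ hs hsρ (card_finset_fin_le σ))
            (norm_nonneg _) (norm_nonneg _)
      _ = _ := by
          rw [Finset.sum_const, Finset.card_univ, Fintype.card_finset, Fintype.card_fin,
            nsmul_eq_mul, div_pow]
          push_cast
          field_simp
  have hTs : Summable T := Summable.of_norm_bounded hsum hTn
  refine ⟨∑' n, T n, tsum_of_norm_bounded hsum.hasSum hTn, fun z hx hy q => ?_⟩
  have h1 : HasSum (fun n => ev z (T n q)) (ev z ((∑' n, T n) q)) := by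
    have h := hTs.hasSum
    have h' := (ContinuousLinearMap.apply ℂ Arr q).hasSum h
    exact (evL z).hasSum h'
  have hmem : ((r * z.1, s * z.2) : ℂ × ℂ) ∈ Metric.eball (0 : ℂ × ℂ) R := by
    rw [mem_eball_zero_iff]
    refine lt_of_le_of_lt ?_ hρ₂
    have : ‖((r * z.1, s * z.2) : ℂ × ℂ)‖ ≤ ρ₂ := by
      rw [Prod.norm_def]
      simp only [norm_mul, Complex.norm_real, Real.norm_of_nonneg hr, Real.norm_of_nonneg hs]
      apply max_le <;> nlinarith [norm_nonneg z.1, norm_nonneg z.2, NNReal.coe_nonneg ρ₂]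
    rw [enorm_eq_nnnorm]
    exact_mod_cast this
  have h2 := (hp.hasSum hmem).mul_right (ev z q)
  rw [zero_add] at h2
  refine h1.unique ?_
  have h3 : (fun n => ev z (T n q)) =
      fun n => (p n fun _ => ((r : ℂ) * z.1, (s : ℂ) * z.2)) * ev z q := ?_
  · rw [h3]; exact h2
  funext n
  rw [multilinear_diag_eq_sum, Finset.sum_mul]
  change evL z (T n q) = _
  rw [hT, _root_.sum_apply, map_sum]
  refine Finset.sum_congr rfl fun σ _ => ?_
  rw [evL_apply]
  change ev z (c n σ • ((((r : ℂ) • mulX) ^ σ.card * ((s : ℂ) • mulY) ^ (n - σ.card)) q)) = _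
  rw [ev_smul, ev_pow_mul_pow hx hy, hc]
  ring

end Arr

/-! ### Splitting off powers of the variables -/

namespace Arr

theorem backX_mulX (a : Arr) : backX (mulX a) = a :=
  congrArg (fun T : Arr →L[ℂ] Arr => T a) backX_mul_mulX
theorem backY_mulY (a : Arr) : backY (mulY a) = a :=
  congrArg (fun T : Arr →L[ℂ] Arr => T a) backY_mul_mulY

variable {z : ℂ × ℂ}

theorem ev_eq_add_mulX (hx : ‖z.1‖ < 1) (hy : ‖z.2‖ < 1) (a : Arr) :
    ev z a = ev z (a - mulX (backX a)) + z.1 * ev z (backX a) := by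
  rw [ev_sub, ev_mulX hx hy]; ring

theorem ev_eq_add_mulY (hx : ‖z.1‖ < 1) (hy : ‖z.2‖ < 1) (a : Arr) :
    ev z a = ev z (a - mulY (backY a)) + z.2 * ev z (backY a) := by
  rw [ev_sub, ev_mulY hx hy]; ring

theorem backX_sub_mulX (a : Arr) : backX (a - mulX (backX a)) = 0 := by
  rw [map_sub, backX_mulX, sub_self]

theorem backY_sub_mulY (a : Arr) : backY (a - mulY (backY a)) = 0 := by
  rw [map_sub, backY_mulY, sub_self]

theorem backX_sub_mulY {a : Arr} (h : backX a = 0) : backX (a - mulY (backY a)) = 0 := by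
  ext n
  have h1 := congrArg (fun b : Arr => b n) h
  have h2 := congrArg (fun b : Arr => b (n.1, n.2 - 1 + 1)) h
  simp only [backX_apply, BoundedContinuousFunction.coe_zero, Pi.zero_apply] at h1 h2
  simp [h1, h2]

theorem exists_ev_eq_add (a : Arr) : ∃ (c : ℂ) (b₁ b₂ : Arr), ∀ z : ℂ × ℂ, ‖z.1‖ < 1 → ‖z.2‖ < 1 →
    ev z a = c + z.1 * ev z b₁ + z.2 * ev z b₂ := by
  set c := a - mulX (backX a) with hc
  refine ⟨ev (0, 0) (c - mulY (backY c)), backX a, backY c, fun z hx hy => ?_⟩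
  rw [ev_eq_add_mulX hx hy a, ← hc, ev_eq_add_mulY hx hy c,
    ev_of_backX_eq_zero (backX_sub_mulY (backX_sub_mulX a)) hx hy,
    ev_of_backY_eq_zero (backY_sub_mulY c) (z := (0, z.2)) hy]
  ring

/-- Induction on the x-exponent of a nonzero coefficient: if no pure power of y occurs, the series
is divisible by x, and dividing lowers the exponent. -/
theorem exists_ev_eq_pow_mul_x (i : ℕ) : ∀ (a : Arr) (j : ℕ), a (i, j) ≠ 0 →
    ∃ (k : ℕ) (b : Arr) (j' : ℕ), b (0, j') ≠ 0 ∧ ∀ z : ℂ × ℂ, ‖z.1‖ < 1 → ‖z.2‖ < 1 →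
      ev z a = z.1 ^ k * ev z b := by
  induction i with
  | zero => exact fun a j h => ⟨0, a, j, h, fun z _ _ => by simp⟩
  | succ i ih =>
    intro a j h
    by_cases h0 : ∃ j', a (0, j') ≠ 0
    · obtain ⟨j', hj'⟩ := h0
      exact ⟨0, a, j', hj', fun z _ _ => by simp⟩
    · push Not at h0
      obtain ⟨k, b, j', hb, hz⟩ := ih (backX a) j h
      refine ⟨k + 1, b, j', hb, fun z hx hy => ?_⟩
      have ha : a = mulX (backX a) := by
        ext ⟨m, n⟩
        rcases m with - | m <;> simp [h0]
      rw [ha, ev_mulX hx hy, hz z hx hy]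
      ring

theorem exists_ev_eq_pow_mul_y (j : ℕ) : ∀ (a : Arr), backX a = 0 → a (0, j) ≠ 0 →
    ∃ (d : ℕ) (b : Arr), b (0, 0) ≠ 0 ∧ ∀ z : ℂ × ℂ, ‖z.1‖ < 1 → ‖z.2‖ < 1 →
      ev z a = z.2 ^ d * ev z b := by
  induction j with
  | zero => exact fun a _ h => ⟨0, a, h, fun z _ _ => by simp⟩
  | succ j ih =>
    intro a h1 h
    by_cases h0 : a (0, 0) ≠ 0
    · exact ⟨0, a, h0, fun z _ _ => by simp⟩
    · push Not at h0
      have h1' : ∀ m n, a (m + 1, n) = 0 := fun m n => congrArg (fun b : Arr => b (m, n)) h1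
      obtain ⟨d, b, hb, hz⟩ := ih (backY a) (by ext n; simp [h1']) h
      refine ⟨d + 1, b, hb, fun z hx hy => ?_⟩
      have ha : a = mulY (backY a) := by
        ext ⟨m, n⟩
        rcases n with - | n
        · rcases m with - | m <;> simp [h0, h1']
        · simp
      rw [ha, ev_mulY hx hy, hz z hx hy]
      ring

theorem exists_ev_eq_regular {a : Arr} (h : a ≠ 0) : ∃ (k d : ℕ) (u w : Arr), u (0, 0) ≠ 0 ∧
    ∀ z : ℂ × ℂ, ‖z.1‖ < 1 → ‖z.2‖ < 1 →
      ev z a = z.1 ^ k * (z.2 ^ d * ev z u + z.1 * ev z w) := by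
  obtain ⟨⟨i, j⟩, hij⟩ : ∃ n, a n ≠ 0 := by
    by_contra! h0
    exact h (by ext n; exact h0 n)
  obtain ⟨k, b, j', hb, hz⟩ := exists_ev_eq_pow_mul_x i a j hij
  obtain ⟨d, u, hu, hz'⟩ := exists_ev_eq_pow_mul_y j' (b - mulX (backX b)) (backX_sub_mulX b)
    (by simpa using hb)
  exact ⟨k, d, u, backX b, hu, fun z hx hy => by
    rw [hz z hx hy, ev_eq_add_mulX hx hy b, hz' z hx hy]⟩

theorem exists_ev_eq_sum (d : ℕ) : ∀ (a : Arr), (backY ^ d) a = 0 →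
    ∃ c : ℕ → Arr, ∀ z : ℂ × ℂ, ‖z.1‖ < 1 → ‖z.2‖ < 1 →
      ev z a = ∑ j ∈ Finset.range d, ev (z.1, 0) (c j) * z.2 ^ j := by
  induction d with
  | zero =>
    intro a h
    have h : a = 0 := h
    exact ⟨fun _ => 0, fun z _ _ => by simp [h, ev_zero]⟩
  | succ d ih =>
    intro a h
    obtain ⟨c, hc⟩ := ih (backY a) h
    refine ⟨fun j => Nat.casesOn j (a - mulY (backY a)) c, fun z hx hy => ?_⟩
    rw [ev_eq_add_mulY hx hy a, hc z hx hy, ev_of_backY_eq_zero (backY_sub_mulY a) hy,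
      Finset.sum_range_succ', Finset.mul_sum]
    simp only [pow_zero, mul_one]
    rw [add_comm]
    congr 1
    exact Finset.sum_congr rfl fun j _ => by ring

end Arr

/-! ### Hadamard's lemma and Weierstrass division -/

open Arr

theorem eventually_norm_div_lt (r s : ℝ) :
    ∀ᶠ z : ℂ × ℂ in 𝓝 0, ‖z.1 / (r : ℂ)‖ < 1 ∧ ‖z.2 / (s : ℂ)‖ < 1 := by
  have h1 : Tendsto (fun z : ℂ × ℂ => ‖z.1 / (r : ℂ)‖) (𝓝 0) (𝓝 0) := by
    have : Continuous (fun z : ℂ × ℂ => ‖z.1 / (r : ℂ)‖) := by fun_prop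
    simpa using this.tendsto 0
  have h2 : Tendsto (fun z : ℂ × ℂ => ‖z.2 / (s : ℂ)‖) (𝓝 0) (𝓝 0) := by
    have : Continuous (fun z : ℂ × ℂ => ‖z.2 / (s : ℂ)‖) := by fun_prop
    simpa using this.tendsto 0
  exact (h1.eventually_lt_const one_pos).and (h2.eventually_lt_const one_pos)

theorem analyticAt_ev_div (a : Arr) (r s : ℂ) :
    AnalyticAt ℂ (fun z : ℂ × ℂ => ev (z.1 / r, z.2 / s) a) 0 := by
  refine (analyticAt_ev a).comp_of_eq (f := fun z : ℂ × ℂ => (z.1 / r, z.2 / s)) ?_ (by simp)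
  simp only [div_eq_mul_inv]
  exact (analyticAt_fst.mul analyticAt_const).prod (analyticAt_snd.mul analyticAt_const)

theorem analyticAt_ev_div_fst (a : Arr) (r : ℂ) :
    AnalyticAt ℂ (fun x : ℂ => ev (x / r, 0) a) 0 := by
  refine (analyticAt_ev a).comp_of_eq (f := fun x : ℂ => (x / r, 0)) ?_ (by simp)
  simp only [div_eq_mul_inv]
  fun_prop

/-- An analytic function is locally the sum of a bounded array, after rescaling. -/
theorem exists_eventually_eq_ev {w : ℂ × ℂ → ℂ} (hw : AnalyticAt ℂ w 0) :
    ∃ ρ : ℝ, 0 < ρ ∧ ∃ a : Arr,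
      ∀ᶠ z : ℂ × ℂ in 𝓝 0, w z = ev (z.1 / ρ, z.2 / ρ) a := by
  obtain ⟨ρ, hρ, C, -, h⟩ := exists_mulOp hw
  obtain ⟨W, -, hW⟩ := h ρ ρ hρ.le le_rfl hρ.le le_rfl
  refine ⟨ρ, hρ, W Arr.one, ?_⟩
  have hρ' : (ρ : ℂ) ≠ 0 := by exact_mod_cast hρ.ne'
  filter_upwards [eventually_norm_div_lt ρ ρ] with z hz
  have h1 := hW (z.1 / ρ, z.2 / ρ) hz.1 hz.2 Arr.one
  rw [h1, ev_one hz.1 hz.2, mul_one, mul_div_cancel₀ _ hρ', mul_div_cancel₀ _ hρ']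

/-- Hadamard's lemma. -/
theorem exists_eq_add_mul_add_mul {w : ℂ × ℂ → ℂ} (hw : AnalyticAt ℂ w 0) :
    ∃ (c : ℂ) (w₁ w₂ : ℂ × ℂ → ℂ), AnalyticAt ℂ w₁ 0 ∧ AnalyticAt ℂ w₂ 0 ∧
      ∀ᶠ z : ℂ × ℂ in 𝓝 0, w z = c + z.1 * w₁ z + z.2 * w₂ z := by
  obtain ⟨ρ, hρ, a, ha⟩ := exists_eventually_eq_ev hw
  obtain ⟨c, b₁, b₂, hb⟩ := exists_ev_eq_add a
  refine ⟨c, fun z => (ρ : ℂ)⁻¹ * ev (z.1 / ρ, z.2 / ρ) b₁,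
    fun z => (ρ : ℂ)⁻¹ * ev (z.1 / ρ, z.2 / ρ) b₂,
    analyticAt_const.mul (analyticAt_ev_div _ _ _),
    analyticAt_const.mul (analyticAt_ev_div _ _ _), ?_⟩
  filter_upwards [ha, eventually_norm_div_lt ρ ρ] with z h1 hz
  rw [h1, hb _ hz.1 hz.2]
  ring

/-- A nonzero analytic function is a power of `x` times a function regular in `y`. -/
theorem exists_eq_pow_mul_regular {F : ℂ × ℂ → ℂ} (hF : AnalyticAt ℂ F 0)
    (h0 : ¬ ∀ᶠ z in 𝓝 0, F z = 0) :
    ∃ (k d : ℕ) (u w : ℂ × ℂ → ℂ), AnalyticAt ℂ u 0 ∧ AnalyticAt ℂ w 0 ∧ u 0 ≠ 0 ∧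
      ∀ᶠ z : ℂ × ℂ in 𝓝 0, F z = z.1 ^ k * (z.2 ^ d * u z + z.1 * w z) := by
  obtain ⟨ρ, hρ, a, ha⟩ := exists_eventually_eq_ev hF
  have hρ' : (ρ : ℂ) ≠ 0 := by exact_mod_cast hρ.ne'
  have ha0 : a ≠ 0 := by
    rintro rfl
    exact h0 (ha.mono fun z hz => by rw [hz, ev_zero])
  obtain ⟨k, d, u, w, hu, h⟩ := exists_ev_eq_regular ha0
  refine ⟨k, d, fun z => ((ρ : ℂ)⁻¹ ^ k * (ρ : ℂ)⁻¹ ^ d) * ev (z.1 / ρ, z.2 / ρ) u,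
    fun z => ((ρ : ℂ)⁻¹ ^ k * (ρ : ℂ)⁻¹) * ev (z.1 / ρ, z.2 / ρ) w,
    analyticAt_const.mul (analyticAt_ev_div _ _ _),
    analyticAt_const.mul (analyticAt_ev_div _ _ _), ?_, ?_⟩
  · simp [hρ', ev_origin, hu]
  · filter_upwards [ha, eventually_norm_div_lt ρ ρ] with z h1 hz
    rw [h1, h _ hz.1 hz.2]
    simp only [div_eq_mul_inv, mul_pow]
    ring

theorem exists_pos_le_mul_lt {ρ ε : ℝ} (hρ : 0 < ρ) (hε : 0 < ε) {C : ℝ} (hC : 0 ≤ C) :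
    ∃ s, 0 < s ∧ s ≤ ρ ∧ s * C < ε := by
  refine ⟨min ρ (ε / (C + 1)), by positivity, min_le_left _ _, ?_⟩
  calc min ρ (ε / (C + 1)) * C ≤ ε / (C + 1) * C := by gcongr; exact min_le_right _ _
    _ < ε := by
      rw [div_mul_eq_mul_div, div_lt_iff₀ (by positivity)]
      nlinarith

theorem norm_mul_le_of_le_one {S T : Arr →L[ℂ] Arr} (hS : ‖S‖ ≤ 1) : ‖S * T‖ ≤ ‖T‖ :=
  (norm_mul_le _ _).trans (mul_le_of_le_one_left (norm_nonneg _) hS)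

theorem norm_pow_le_one {S : Arr →L[ℂ] Arr} (hS : ‖S‖ ≤ 1) (d : ℕ) : ‖S ^ d‖ ≤ 1 :=
  (norm_pow_le _ _).trans (pow_le_one₀ (norm_nonneg _) hS)

theorem backY_pow_mul_mulY_pow (d : ℕ) : backY ^ d * mulY ^ d = 1 := by
  induction d with
  | zero => simp
  | succ d ih =>
    rw [pow_succ, pow_succ', mul_assoc, ← mul_assoc backY, backY_mul_mulY, one_mul, ih]

theorem ev_mulY_pow {z : ℂ × ℂ} (hx : ‖z.1‖ < 1) (hy : ‖z.2‖ < 1) (d : ℕ) (a : Arr) :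
    ev z ((mulY ^ d) a) = z.2 ^ d * ev z a := by
  simpa using ev_pow_mul_pow hx hy 1 1 0 d a

/-- **Weierstrass division** by a function `y ^ d u + x w` with `u 0 ≠ 0`. -/
theorem weierstrass_division {u w h : ℂ × ℂ → ℂ} (hu : AnalyticAt ℂ u 0) (hw : AnalyticAt ℂ w 0)
    (hh : AnalyticAt ℂ h 0) (hu0 : u 0 ≠ 0) (d : ℕ) :
    ∃ (q : ℂ × ℂ → ℂ) (c : ℕ → ℂ → ℂ), AnalyticAt ℂ q 0 ∧ (∀ j, AnalyticAt ℂ (c j) 0) ∧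
      ∀ᶠ z : ℂ × ℂ in 𝓝 0, h z = (z.2 ^ d * u z + z.1 * w z) * q z
        + ∑ j ∈ Finset.range d, c j z.1 * z.2 ^ j := by
  obtain ⟨u₀, u₁, u₂, hu₁, hu₂, hu'⟩ := exists_eq_add_mul_add_mul hu
  have hu₀ : u₀ ≠ 0 := by
    have := hu'.self_of_nhds
    simp at this
    rwa [← this]
  obtain ⟨ρ₁, hρ₁, C₁, hC₁, hU₁⟩ := exists_mulOp hu₁
  obtain ⟨ρ₂, hρ₂, C₂, hC₂, hU₂⟩ := exists_mulOp hu₂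
  obtain ⟨ρ₃, hρ₃, C₃, hC₃, hW⟩ := exists_mulOp hw
  obtain ⟨ρ₄, hρ₄, C₄, hC₄, hH⟩ := exists_mulOp hh
  obtain ⟨ρ, hρ, h1, h2, h3, h4⟩ : ∃ ρ : ℝ, 0 < ρ ∧ ρ ≤ ρ₁ ∧ ρ ≤ ρ₂ ∧ ρ ≤ ρ₃ ∧ ρ ≤ ρ₄ :=
    ⟨min (min ρ₁ ρ₂) (min ρ₃ ρ₄), by positivity, by simp, by simp, by simp, by simp⟩
  set κ : ℝ := ‖u₀‖ with hκ
  have hκ0 : 0 < κ := norm_pos_iff.2 hu₀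
  -- The order of choice matters: s is fixed first, and r is then taken small even against the
  -- factor 1/s^d.
  obtain ⟨s, hs, hsρ, hsC⟩ := exists_pos_le_mul_lt hρ (half_pos hκ0) hC₂
  obtain ⟨r, hr, hrρ, hrC⟩ := exists_pos_le_mul_lt hρ (half_pos hκ0)
    (C := C₁ + C₃ / s ^ d) (by positivity)
  have hr' : (r : ℂ) ≠ 0 := by exact_mod_cast hr.ne'
  have hs' : (s : ℂ) ≠ 0 := by exact_mod_cast hs.ne'
  obtain ⟨U₁, hU₁n, hU₁e⟩ := hU₁ r s hr.le (hrρ.trans h1) hs.le (hsρ.trans h1)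
  obtain ⟨U₂, hU₂n, hU₂e⟩ := hU₂ r s hr.le (hrρ.trans h2) hs.le (hsρ.trans h2)
  obtain ⟨W, hWn, hWe⟩ := hW r s hr.le (hrρ.trans h3) hs.le (hsρ.trans h3)
  obtain ⟨H, -, hHe⟩ := hH r s hr.le (hrρ.trans h4) hs.le (hsρ.trans h4)
  -- After rescaling, multiplication by the divisor is s^d (u₀ `mulY`^d + E), and E is smaller in
  -- norm than |u₀|.
  set E : Arr →L[ℂ] Arr := (r : ℂ) • (mulY ^ d * (mulX * U₁)) + (s : ℂ) • (mulY ^ d * (mulY * U₂))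
    + ((r / s ^ d : ℝ) : ℂ) • (mulX * W) with hE
  have hEn : ‖E‖ < κ := by
    have e1 : ‖(r : ℂ) • (mulY ^ d * (mulX * U₁))‖ ≤ r * C₁ := by
      rw [norm_smul, Complex.norm_real, Real.norm_of_nonneg hr.le]
      gcongr
      exact (norm_mul_le_of_le_one (norm_pow_le_one norm_mulY_le d)).trans
        ((norm_mul_le_of_le_one norm_mulX_le).trans hU₁n)
    have e2 : ‖(s : ℂ) • (mulY ^ d * (mulY * U₂))‖ ≤ s * C₂ := by
      rw [norm_smul, Complex.norm_real, Real.norm_of_nonneg hs.le]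
      gcongr
      exact (norm_mul_le_of_le_one (norm_pow_le_one norm_mulY_le d)).trans
        ((norm_mul_le_of_le_one norm_mulY_le).trans hU₂n)
    have e3 : ‖((r / s ^ d : ℝ) : ℂ) • (mulX * W)‖ ≤ r / s ^ d * C₃ := by
      rw [norm_smul, Complex.norm_real, Real.norm_of_nonneg (by positivity)]
      gcongr
      exact (norm_mul_le_of_le_one norm_mulX_le).trans hWn
    have e4 : r * (C₁ + C₃ / s ^ d) = r * C₁ + r / s ^ d * C₃ := by ring
    rw [hE]
    refine lt_of_le_of_lt ((norm_add_le _ _).trans (add_le_add (norm_add_le _ _) le_rfl)) ?_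
    linarith
  set N : Arr →L[ℂ] Arr := -(u₀⁻¹ • (backY ^ d * E)) with hN
  have hNn : ‖N‖ < 1 := by
    rw [hN, norm_neg, norm_smul, norm_inv, inv_mul_lt_iff₀ hκ0, mul_one]
    exact (norm_mul_le_of_le_one (norm_pow_le_one norm_backY_le d)).trans_lt hEn
  have hunit : IsUnit (1 - N) :=
    isUnit_one_sub_of_norm_lt_one (R := Arr →L[ℂ] Arr) (x := N) hNn
  set f := H Arr.one with hf
  -- Applying `backY`^d discards the terms of degree below d in y, so the quotient must solve (1 −
  -- N) q = `backY`^d f. This is possible because ‖N‖ < 1. What remains is killed by `backY`^d and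
  -- is a polynomial in y.
  set q : Arr := Ring.inverse (1 - N) ((backY ^ d) f) with hq
  have hqe : q - N q = (backY ^ d) f := by
    have := congrArg (fun T : Arr →L[ℂ] Arr => T ((backY ^ d) f))
      (Ring.mul_inverse_cancel _ hunit)
    exact this
  have hrem : (backY ^ d) (f - ((mulY ^ d) q + u₀⁻¹ • E q)) = 0 := by
    have hb : (backY ^ d) ((mulY ^ d) q) = q :=
      congrArg (fun T : Arr →L[ℂ] Arr => T q) (backY_pow_mul_mulY_pow d)
    have hNq : N q = -(u₀⁻¹ • (backY ^ d) (E q)) := rfl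
    rw [map_sub, map_add, map_smul, hb, ← hqe, hNq]
    abel
  obtain ⟨c, hc⟩ := exists_ev_eq_sum d _ hrem
  refine ⟨fun z => (u₀⁻¹ * ((s : ℂ)⁻¹) ^ d) * ev (z.1 / r, z.2 / s) q,
    fun j x => ev (x / r, 0) (c j) * ((s : ℂ)⁻¹) ^ j,
    analyticAt_const.mul (analyticAt_ev_div _ _ _),
    fun j => (analyticAt_ev_div_fst _ _).mul analyticAt_const, ?_⟩
  filter_upwards [hu', eventually_norm_div_lt r s] with z hz1 hz
  obtain ⟨hx, hy⟩ := hz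
  set ζ : ℂ × ℂ := (z.1 / r, z.2 / s) with hζ
  change ‖ζ.1‖ < 1 at hx
  change ‖ζ.2‖ < 1 at hy
  have hzx : (r : ℂ) * ζ.1 = z.1 := mul_div_cancel₀ _ hr'
  have hzy : (s : ℂ) * ζ.2 = z.2 := mul_div_cancel₀ _ hs'
  have k1 := hU₁e ζ hx hy q
  have k2 := hU₂e ζ hx hy q
  have k3 := hWe ζ hx hy q
  have k4 := hHe ζ hx hy Arr.one
  rw [hzx, hzy, Prod.mk.eta] at k1 k2 k3 k4
  rw [ev_one hx hy, mul_one] at k4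
  have k5 := hc ζ hx hy
  have k6 : ev ζ (E q) = r * (ζ.2 ^ d * (ζ.1 * (u₁ z * ev ζ q)))
      + s * (ζ.2 ^ d * (ζ.2 * (u₂ z * ev ζ q))) + (r / s ^ d : ℝ) * (ζ.1 * (w z * ev ζ q)) := by
    change ev ζ ((r : ℂ) • ((mulY ^ d) (mulX (U₁ q))) + (s : ℂ) • ((mulY ^ d) (mulY (U₂ q)))
      + ((r / s ^ d : ℝ) : ℂ) • (mulX (W q))) = _
    simp only [ev_add, ev_smul, ev_mulY_pow hx hy, ev_mulX hx hy, ev_mulY hx hy, k1, k2, k3]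
  rw [ev_sub, ev_add, ev_smul, ev_mulY_pow hx hy, k6, ← hf.symm, k4] at k5
  have k7 : ∑ j ∈ Finset.range d, ev (z.1 / r, 0) (c j) * ((s : ℂ)⁻¹) ^ j * z.2 ^ j
      = ∑ j ∈ Finset.range d, ev (ζ.1, 0) (c j) * ζ.2 ^ j := by
    refine Finset.sum_congr rfl fun j _ => ?_
    rw [hζ, div_eq_mul_inv z.2, mul_pow]
    ring
  rw [k7, ← k5, hz1]
  generalize h z = A, u₁ z = B₁, u₂ z = B₂, w z = B₃, ev ζ q = Q
  rw [← hzx, ← hzy]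
  generalize ζ.1 = X, ζ.2 = Y
  push_cast
  rw [inv_pow]
  field_simp
  ring

/-! ### The ring 𝒪₂: units, derivations, coordinates -/

/-- The germ of an analytic function. -/
def ofFun (F : ℂ × ℂ → ℂ) (hF : AnalyticAt ℂ F 0) : O2 := ⟨(F : Germ (𝓝 (0 : ℂ × ℂ)) ℂ), F, hF, rfl⟩

theorem exists_ofFun (f : O2) : ∃ F hF, f = ofFun F hF := by
  obtain ⟨_, F, hF, rfl⟩ := f
  exact ⟨F, hF, rfl⟩

theorem ofFun_eq_iff {F G : ℂ × ℂ → ℂ} {hF : AnalyticAt ℂ F 0} {hG : AnalyticAt ℂ G 0} :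
    ofFun F hF = ofFun G hG ↔ ∀ᶠ z in 𝓝 0, F z = G z := by
  rw [Subtype.ext_iff]
  exact Germ.coe_eq

theorem ofFun_mul {F G : ℂ × ℂ → ℂ} (hF : AnalyticAt ℂ F 0) (hG : AnalyticAt ℂ G 0) :
    ofFun F hF * ofFun G hG = ofFun (fun z => F z * G z) (hF.mul hG) := rfl

theorem ofFun_add {F G : ℂ × ℂ → ℂ} (hF : AnalyticAt ℂ F 0) (hG : AnalyticAt ℂ G 0) :
    ofFun F hF + ofFun G hG = ofFun (fun z => F z + G z) (hF.add hG) := rfl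

theorem ofFun_pow {F : ℂ × ℂ → ℂ} (hF : AnalyticAt ℂ F 0) (n : ℕ) :
    ofFun F hF ^ n = ofFun (fun z => F z ^ n) (hF.pow n) := by
  induction n with
  | zero => simp only [pow_zero]; rfl
  | succ n ih => rw [pow_succ, ih, ofFun_mul]; simp only [pow_succ]

theorem algebraMap_eq_ofFun (c : ℂ) : algebraMap ℂ O2 c = ofFun (fun _ => c) analyticAt_const := by
  rw [Algebra.algebraMap_eq_smul_one, ofFun, Subtype.ext_iff]
  change (((fun _ => c • (1 : ℂ)) : ℂ × ℂ → ℂ) : Germ (𝓝 (0 : ℂ × ℂ)) ℂ) = _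
  simp

theorem zero_eq_ofFun : (0 : O2) = ofFun (fun _ => 0) analyticAt_const := rfl

/-- The coordinate germ `x`. -/
def X : O2 := ofFun Prod.fst analyticAt_fst

/-- The coordinate germ `y`. -/
def Y : O2 := ofFun Prod.snd analyticAt_snd

/-- Evaluation at the origin as a ring homomorphism. -/
def valueHom : O2 →ₐ[ℂ] ℂ where
  toFun := value
  map_one' := rfl
  map_mul' f g := by
    obtain ⟨F, hF, rfl⟩ := exists_ofFun f
    obtain ⟨G, hG, rfl⟩ := exists_ofFun g
    rfl
  map_zero' := rfl
  map_add' f g := by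
    obtain ⟨F, hF, rfl⟩ := exists_ofFun f
    obtain ⟨G, hG, rfl⟩ := exists_ofFun g
    rfl
  commutes' c := by rw [algebraMap_eq_ofFun]; rfl

@[simp] theorem value_ofFun {F : ℂ × ℂ → ℂ} (hF : AnalyticAt ℂ F 0) : value (ofFun F hF) = F 0 := rfl
@[simp] theorem value_mul (f g : O2) : value (f * g) = value f * value g := valueHom.map_mul f g
@[simp] theorem value_add (f g : O2) : value (f + g) = value f + value g := valueHom.map_add f g
@[simp] theorem value_sub (f g : O2) : value (f - g) = value f - value g := valueHom.map_sub f g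
@[simp] theorem value_pow (f : O2) (n : ℕ) : value (f ^ n) = value f ^ n := valueHom.map_pow f n
@[simp] theorem value_one : value 1 = 1 := valueHom.map_one
@[simp] theorem value_algebraMap (c : ℂ) : value (algebraMap ℂ O2 c) = c := valueHom.commutes c
@[simp] theorem value_natCast (n : ℕ) : value (n : O2) = n := map_natCast valueHom n
@[simp] theorem value_X : value X = 0 := rfl
@[simp] theorem value_Y : value Y = 0 := rfl

theorem isUnit_iff_value_ne_zero {f : O2} : IsUnit f ↔ value f ≠ 0 := by
  constructor
  · intro h
    exact (h.map valueHom).ne_zero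
  · intro h
    obtain ⟨F, hF, rfl⟩ := exists_ofFun f
    rw [value_ofFun] at h
    refine IsUnit.of_mul_eq_one (ofFun (fun z => (F z)⁻¹) (hF.inv h)) ?_
    rw [ofFun_mul]
    refine ofFun_eq_iff (hG := analyticAt_const (v := (1 : ℂ))).2 ?_
    filter_upwards [hF.continuousAt.eventually_ne h] with z hz
    exact mul_inv_cancel₀ hz

theorem analyticAt_fderiv_apply {F : ℂ × ℂ → ℂ} (hF : AnalyticAt ℂ F 0) (v : ℂ × ℂ) :
    AnalyticAt ℂ (fun p => fderiv ℂ F p v) 0 :=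
  (ContinuousLinearMap.analyticAt (ContinuousLinearMap.apply ℂ ℂ v) _).comp hF.fderiv

theorem dx_ofFun {F : ℂ × ℂ → ℂ} (hF : AnalyticAt ℂ F 0) :
    dx (ofFun F hF) = ofFun (fun p => fderiv ℂ F p (1, 0)) (analyticAt_fderiv_apply hF _) := rfl

theorem dy_ofFun {F : ℂ × ℂ → ℂ} (hF : AnalyticAt ℂ F 0) :
    dy (ofFun F hF) = ofFun (fun p => fderiv ℂ F p (0, 1)) (analyticAt_fderiv_apply hF _) := rfl

/-- Directional derivatives are derivations. -/
def dirDeriv (v : ℂ × ℂ) : Derivation ℂ O2 O2 where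
  toFun f := ⟨germDeriv v f, germDeriv_mem v f.2⟩
  map_add' f g := by
    obtain ⟨F, hF, rfl⟩ := exists_ofFun f
    obtain ⟨G, hG, rfl⟩ := exists_ofFun g
    refine (ofFun_eq_iff (hF := analyticAt_fderiv_apply (hF.add hG) v)
      (hG := (analyticAt_fderiv_apply hF v).add (analyticAt_fderiv_apply hG v))).2 ?_
    filter_upwards [hF.eventually_analyticAt, hG.eventually_analyticAt] with z h1 h2
    rw [fderiv_add h1.differentiableAt h2.differentiableAt]
    rfl
  map_smul' c f := by
    obtain ⟨F, hF, rfl⟩ := exists_ofFun f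
    refine (ofFun_eq_iff (hF := analyticAt_fderiv_apply (hF.const_smul (c := c)) v)
      (hG := (analyticAt_fderiv_apply hF v).const_smul (c := c))).2 ?_
    filter_upwards [hF.eventually_analyticAt] with z h1
    rw [fderiv_const_smul h1.differentiableAt]
    rfl
  map_one_eq_zero' := by
    refine (ofFun_eq_iff (hF := analyticAt_fderiv_apply (analyticAt_const (v := (1 : ℂ))) v)
      (hG := analyticAt_const (v := (0 : ℂ)))).2 ?_
    filter_upwards with z
    simp
  leibniz' f g := by
    obtain ⟨F, hF, rfl⟩ := exists_ofFun f
    obtain ⟨G, hG, rfl⟩ := exists_ofFun g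
    refine (ofFun_eq_iff (hF := analyticAt_fderiv_apply (hF.mul hG) v)
      (hG := (hF.mul (analyticAt_fderiv_apply hG v)).add
        (hG.mul (analyticAt_fderiv_apply hF v)))).2 ?_
    filter_upwards [hF.eventually_analyticAt, hG.eventually_analyticAt] with z h1 h2
    rw [fderiv_mul h1.differentiableAt h2.differentiableAt]
    rfl

theorem dirDeriv_zero_one (f : O2) : dirDeriv (0, 1) f = dy f := rfl

@[simp] theorem dx_mul (f g : O2) : dx (f * g) = f * dx g + g * dx f := (dirDeriv (1, 0)).leibniz f g
@[simp] theorem dy_mul (f g : O2) : dy (f * g) = f * dy g + g * dy f := (dirDeriv (0, 1)).leibniz f g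
@[simp] theorem dx_add (f g : O2) : dx (f + g) = dx f + dx g := (dirDeriv (1, 0)).map_add f g
@[simp] theorem dy_add (f g : O2) : dy (f + g) = dy f + dy g := (dirDeriv (0, 1)).map_add f g
@[simp] theorem dx_sub (f g : O2) : dx (f - g) = dx f - dx g := (dirDeriv (1, 0)).map_sub f g
@[simp] theorem dy_sub (f g : O2) : dy (f - g) = dy f - dy g := (dirDeriv (0, 1)).map_sub f g
@[simp] theorem dx_neg (f : O2) : dx (-f) = -dx f := (dirDeriv (1, 0)).map_neg f
@[simp] theorem dy_neg (f : O2) : dy (-f) = -dy f := (dirDeriv (0, 1)).map_neg f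
@[simp] theorem dx_algebraMap (c : ℂ) : dx (algebraMap ℂ O2 c) = 0 :=
  (dirDeriv (1, 0)).map_algebraMap c
@[simp] theorem dy_algebraMap (c : ℂ) : dy (algebraMap ℂ O2 c) = 0 :=
  (dirDeriv (0, 1)).map_algebraMap c
@[simp] theorem dx_one : dx 1 = 0 := (dirDeriv (1, 0)).map_one_eq_zero
@[simp] theorem dy_one : dy 1 = 0 := (dirDeriv (0, 1)).map_one_eq_zero

theorem dy_pow (f : O2) (n : ℕ) : dy (f ^ n) = n * f ^ (n - 1) * dy f := by
  have := (dirDeriv (0, 1)).leibniz_pow f n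
  rw [dirDeriv_zero_one, dirDeriv_zero_one] at this
  rw [this, nsmul_eq_mul, smul_eq_mul, mul_assoc]

@[simp] theorem dx_X : dx X = 1 := by
  refine (ofFun_eq_iff (hF := analyticAt_fderiv_apply analyticAt_fst _)
    (hG := analyticAt_const (v := (1 : ℂ)))).2 ?_
  filter_upwards with z
  simp [fderiv_fst]
@[simp] theorem dy_X : dy X = 0 := by
  refine (ofFun_eq_iff (hF := analyticAt_fderiv_apply analyticAt_fst _)
    (hG := analyticAt_const (v := (0 : ℂ)))).2 ?_
  filter_upwards with z
  simp [fderiv_fst]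
@[simp] theorem dx_Y : dx Y = 0 := by
  refine (ofFun_eq_iff (hF := analyticAt_fderiv_apply analyticAt_snd _)
    (hG := analyticAt_const (v := (0 : ℂ)))).2 ?_
  filter_upwards with z
  simp [fderiv_snd]
@[simp] theorem dy_Y : dy Y = 1 := by
  refine (ofFun_eq_iff (hF := analyticAt_fderiv_apply analyticAt_snd _)
    (hG := analyticAt_const (v := (1 : ℂ)))).2 ?_
  filter_upwards with z
  simp [fderiv_snd]

/-- Symmetry of mixed partial derivatives. -/
theorem dx_dy (f : O2) : dx (dy f) = dy (dx f) := by
  obtain ⟨F, hF, rfl⟩ := exists_ofFun f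
  rw [dx_ofFun, dy_ofFun, dx_ofFun, dy_ofFun]
  refine ofFun_eq_iff.2 ?_
  filter_upwards [hF.eventually_analyticAt] with z hz
  have hs : IsSymmSndFDerivAt ℂ F z := hz.contDiffAt.isSymmSndFDerivAt_of_omega
  have hd : DifferentiableAt ℂ (fderiv ℂ F) z := hz.fderiv.differentiableAt
  rw [fderiv_clm_apply hd (by fun_prop), fderiv_clm_apply hd (by fun_prop)]
  simpa using hs (1, 0) (0, 1)

theorem exists_eq_value_add (h : O2) :
    ∃ h₁ h₂ : O2, h = algebraMap ℂ O2 (value h) + X * h₁ + Y * h₂ := by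
  obtain ⟨H, hH, rfl⟩ := exists_ofFun h
  obtain ⟨c, w₁, w₂, hw₁, hw₂, e⟩ := exists_eq_add_mul_add_mul hH
  have hc : H 0 = c := by simpa using e.self_of_nhds
  refine ⟨ofFun w₁ hw₁, ofFun w₂ hw₂, ?_⟩
  rw [value_ofFun, hc, algebraMap_eq_ofFun, X, Y, ofFun_mul, ofFun_mul, ofFun_add, ofFun_add]
  exact ofFun_eq_iff.2 e

theorem exists_eq_X_pow_mul {f : O2} (hf : f ≠ 0) :
    ∃ (k d : ℕ) (u w : O2), IsUnit u ∧ f = X ^ k * (Y ^ d * u + X * w) := by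
  obtain ⟨F, hF, rfl⟩ := exists_ofFun f
  have h0 : ¬ ∀ᶠ z in 𝓝 0, F z = 0 := fun h => hf (by rw [zero_eq_ofFun]; exact ofFun_eq_iff.2 h)
  obtain ⟨k, d, u, w, hu, hw, hu0, e⟩ := exists_eq_pow_mul_regular hF h0
  refine ⟨k, d, ofFun u hu, ofFun w hw, isUnit_iff_value_ne_zero.2 hu0, ?_⟩
  rw [X, Y, ofFun_pow, ofFun_pow, ofFun_mul, ofFun_mul, ofFun_add, ofFun_mul]
  exact ofFun_eq_iff.2 e

/-! ### Germs in `x` alone and division in 𝒪₂ -/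

/-- The subalgebra of germs of functions of `x` alone. -/
def xGerms : Subalgebra ℂ O2 where
  carrier := {h | ∃ (c : ℂ → ℂ) (hc : AnalyticAt ℂ c 0),
    h = ofFun (fun z => c z.1) (hc.comp_of_eq (f := Prod.fst) analyticAt_fst rfl)}
  mul_mem' := by
    rintro _ _ ⟨a, ha, rfl⟩ ⟨b, hb, rfl⟩
    exact ⟨fun x => a x * b x, ha.mul hb, rfl⟩
  add_mem' := by
    rintro _ _ ⟨a, ha, rfl⟩ ⟨b, hb, rfl⟩
    exact ⟨fun x => a x + b x, ha.add hb, rfl⟩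
  algebraMap_mem' := fun c => ⟨fun _ => c, analyticAt_const, algebraMap_eq_ofFun c⟩

theorem X_mem_xGerms : X ∈ xGerms := ⟨fun x => x, analyticAt_id, rfl⟩

theorem fderiv_comp_fst {c : ℂ → ℂ} {z : ℂ × ℂ} (hc : AnalyticAt ℂ c z.1) (v : ℂ × ℂ) :
    fderiv ℂ (fun z : ℂ × ℂ => c z.1) z v = v.1 * deriv c z.1 := by
  have h := (hc.differentiableAt.hasDerivAt.hasFDerivAt.comp z
    (hasFDerivAt_fst (𝕜 := ℂ) (E := ℂ) (F := ℂ) (p := z)))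
  change HasFDerivAt (fun z : ℂ × ℂ => c z.1) _ z at h
  rw [h.fderiv]
  simp

theorem eventually_fst {p : ℂ → Prop} (h : ∀ᶠ x in 𝓝 0, p x) : ∀ᶠ z : ℂ × ℂ in 𝓝 0, p z.1 :=
  (continuous_fst.tendsto (0 : ℂ × ℂ)).eventually h

theorem dy_eq_zero_of_mem {h : O2} (hh : h ∈ xGerms) : dy h = 0 := by
  obtain ⟨c, hc, rfl⟩ := hh
  rw [dy_ofFun, zero_eq_ofFun]
  refine ofFun_eq_iff.2 ?_
  filter_upwards [eventually_fst hc.eventually_analyticAt] with z hz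
  rw [fderiv_comp_fst hz, zero_mul]

theorem dx_ofFun_fst {c : ℂ → ℂ} (hc : AnalyticAt ℂ c 0) :
    dx (ofFun (fun z => c z.1) (hc.comp_of_eq (f := Prod.fst) analyticAt_fst rfl)) =
      ofFun (fun z => deriv c z.1) (hc.deriv.comp_of_eq (f := Prod.fst) analyticAt_fst rfl) := by
  rw [dx_ofFun]
  refine ofFun_eq_iff.2 ?_
  filter_upwards [eventually_fst hc.eventually_analyticAt] with z hz
  rw [fderiv_comp_fst hz, one_mul]

theorem dx_mem {h : O2} (hh : h ∈ xGerms) : dx h ∈ xGerms := by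
  obtain ⟨c, hc, rfl⟩ := hh
  exact ⟨deriv c, hc.deriv, dx_ofFun_fst hc⟩

theorem eventually_of_eventually_fst {p : ℂ → Prop} (h : ∀ᶠ z : ℂ × ℂ in 𝓝 0, p z.1) :
    ∀ᶠ x in 𝓝 0, p x := by
  have h1 : Tendsto (fun x : ℂ => (x, (0 : ℂ))) (𝓝 0) (𝓝 (0 : ℂ × ℂ)) := by
    have : Continuous (fun x : ℂ => (x, (0 : ℂ))) := by fun_prop
    exact this.tendsto 0
  exact h1.eventually h

/-- The order of c − c(0) is one more than the order of its derivative, so it is infinite when the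
derivative vanishes. -/
theorem eq_algebraMap_of_dx_eq_zero {h : O2} (hh : h ∈ xGerms) (h0 : dx h = 0) :
    h = algebraMap ℂ O2 (value h) := by
  obtain ⟨c, hc, rfl⟩ := hh
  rw [dx_ofFun_fst hc, zero_eq_ofFun, ofFun_eq_iff] at h0
  have h1 := eventually_of_eventually_fst (p := fun x => deriv c x = 0) h0
  have h2 := hc.analyticOrderAt_deriv_add_one
  rw [analyticOrderAt_eq_top.2 h1, top_add, eq_comm, analyticOrderAt_eq_top] at h2
  rw [algebraMap_eq_ofFun, value_ofFun]
  refine ofFun_eq_iff.2 ?_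
  filter_upwards [eventually_fst h2] with z hz
  exact sub_eq_zero.1 hz

/-- A nonzero germ of a function of `x` is a power of `x` times a unit. -/
theorem exists_eq_X_pow_mul_unit {h : O2} (hh : h ∈ xGerms) (h0 : h ≠ 0) :
    ∃ (k : ℕ) (v v' : O2), v ∈ xGerms ∧ v' ∈ xGerms ∧ v * v' = 1 ∧ h = X ^ k * v := by
  obtain ⟨c, hc, rfl⟩ := hh
  have h1 : analyticOrderAt c 0 ≠ ⊤ := fun h => h0 (by
    rw [zero_eq_ofFun]
    exact ofFun_eq_iff.2 (eventually_fst (analyticOrderAt_eq_top.1 h)))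
  obtain ⟨v, hv, hv0, e⟩ := (hc.analyticOrderAt_ne_top).1 h1
  refine ⟨analyticOrderNatAt c 0, _, _, ⟨v, hv, rfl⟩, ⟨fun x => (v x)⁻¹, hv.inv hv0, rfl⟩, ?_, ?_⟩
  · rw [ofFun_mul]
    refine ofFun_eq_iff (hG := analyticAt_const (v := (1 : ℂ))).2 ?_
    filter_upwards [eventually_fst (hv.continuousAt.eventually_ne hv0)] with z hz
    exact mul_inv_cancel₀ hz
  · rw [X, ofFun_pow, ofFun_mul]
    refine ofFun_eq_iff.2 ?_
    filter_upwards [eventually_fst e] with z hz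
    rw [hz, sub_zero, smul_eq_mul]

theorem ofFun_sum {ι : Type*} (s : Finset ι) {F : ι → ℂ × ℂ → ℂ} (hF : ∀ i, AnalyticAt ℂ (F i) 0)
    (h : AnalyticAt ℂ (fun z => ∑ i ∈ s, F i z) 0) :
    ∑ i ∈ s, ofFun (F i) (hF i) = ofFun (fun z => ∑ i ∈ s, F i z) h := by
  classical
  induction s using Finset.induction_on with
  | empty => simp only [Finset.sum_empty]; rfl
  | insert a s ha ih =>
    rw [Finset.sum_insert ha, ih (by fun_prop), ofFun_add]
    exact ofFun_eq_iff.2 (by simp [Finset.sum_insert ha])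

theorem exists_division {d : ℕ} {u w : O2} (hu : IsUnit u) (h : O2) :
    ∃ (q : O2) (c : ℕ → O2), (∀ j, c j ∈ xGerms) ∧
      h = (Y ^ d * u + X * w) * q + ∑ j ∈ Finset.range d, c j * Y ^ j := by
  obtain ⟨u, hu', rfl⟩ := exists_ofFun u
  obtain ⟨w, hw, rfl⟩ := exists_ofFun w
  obtain ⟨h, hh, rfl⟩ := exists_ofFun h
  obtain ⟨q, c, hq, hc, e⟩ := weierstrass_division hu' hw hh (isUnit_iff_value_ne_zero.1 hu) d
  have hc' : ∀ j, AnalyticAt ℂ (fun z : ℂ × ℂ => c j z.1) 0 := fun j =>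
    (hc j).comp_of_eq (f := Prod.fst) analyticAt_fst rfl
  refine ⟨ofFun q hq, fun j => ofFun (fun z => c j z.1) (hc' j), fun j => ⟨c j, hc j, rfl⟩, ?_⟩
  have hm : ∀ j, AnalyticAt ℂ (fun z : ℂ × ℂ => c j z.1 * z.2 ^ j) 0 := fun j =>
    (hc' j).mul (analyticAt_snd.pow j)
  have h1 : ∑ j ∈ Finset.range d, ofFun (fun z => c j z.1) (hc' j) * Y ^ j =
      ofFun (fun z => ∑ j ∈ Finset.range d, c j z.1 * z.2 ^ j)
        (Finset.analyticAt_fun_sum _ fun j _ => hm j) := by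
    rw [← ofFun_sum _ hm]
    simp only [Y, ofFun_pow, ofFun_mul]
  rw [h1, X, Y, ofFun_pow, ofFun_mul, ofFun_mul, ofFun_add, ofFun_mul, ofFun_add]
  exact ofFun_eq_iff.2 e

theorem value_eq_zero_of_mem {P : Ideal O2} (hP : P ≠ ⊤) {h : O2} (hh : h ∈ P) : value h = 0 := by
  by_contra h0
  exact hP (P.eq_top_of_isUnit_mem hh (isUnit_iff_value_ne_zero.2 h0))

/-! ### Prime ideals of 𝒪₂ and components -/

/-- `f` is regular of order `d` in `y`. -/
def IsRegularY (d : ℕ) (f : O2) : Prop := ∃ u w : O2, IsUnit u ∧ f = Y ^ d * u + X * w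

theorem isUnit_add_of_value {u h : O2} (hu : IsUnit u) (hh : value h = 0) : IsUnit (u + h) := by
  rw [isUnit_iff_value_ne_zero] at hu ⊢
  rwa [value_add, hh, add_zero]

/-- Applied to a remainder of Weierstrass division, this yields an element of smaller regularity
order. It is the descent behind `exists_generator`. -/
theorem sum_eq_X_pow_mul_regular (d : ℕ) (c : ℕ → O2) (hc : ∀ j, c j ∈ xGerms) :
    (∑ j ∈ Finset.range d, c j * Y ^ j = 0) ∨ ∃ (k d' : ℕ) (g : O2), d' < d ∧ IsRegularY d' g ∧
      ∑ j ∈ Finset.range d, c j * Y ^ j = X ^ k * g := by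
  induction d with
  | zero => exact Or.inl rfl
  | succ d ih =>
    rw [Finset.sum_range_succ]
    by_cases h0 : c d = 0
    · rw [h0, zero_mul, add_zero]
      exact ih.imp_right fun ⟨k, d', g, h1, h2⟩ => ⟨k, d', g, h1.trans d.lt_succ_self, h2⟩
    · obtain ⟨l, v, v', -, -, hv, e⟩ := exists_eq_X_pow_mul_unit (hc d) h0
      have hvu : IsUnit v := IsUnit.of_mul_eq_one v' hv
      right
      rcases ih with h | ⟨k, d', g, hd, ⟨u, w, hu, rfl⟩, h⟩
      · exact ⟨l, d, Y ^ d * v, d.lt_succ_self, ⟨v, 0, hvu, by ring⟩, by rw [h, e]; ring⟩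
      -- Compare the power of x in the new top coefficient with the one already split off. If it is
      -- not smaller, the new term only perturbs the unit; otherwise the new term becomes the
      -- leading one.
      · rcases le_or_gt k l with hkl | hkl
        · obtain ⟨m, rfl⟩ := Nat.exists_eq_add_of_le hkl
          obtain ⟨t, rfl⟩ := Nat.exists_eq_add_of_lt hd
          refine ⟨k, d', _, by omega, ⟨u + X ^ m * v * Y ^ (t + 1), w,
            isUnit_add_of_value hu (by simp), rfl⟩, ?_⟩
          rw [h, e]; ring
        · obtain ⟨m, rfl⟩ := Nat.exists_eq_add_of_lt hkl
          refine ⟨l, d, _, d.lt_succ_self, ⟨v, X ^ m * (Y ^ d' * u + X * w), hvu, rfl⟩, ?_⟩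
          rw [h, e]; ring

/-- A nonzero prime ideal of `𝒪₂` not containing `x` is principal, its generator does not divide its
`y`-derivative, and the quotient is finite over the germs in `x`. -/
theorem exists_generator {P : Ideal O2} (hP : P.IsPrime) (hX : X ∉ P) {f : O2} (hf : f ∈ P)
    (hf0 : f ≠ 0) : ∃ (p : O2) (d : ℕ), P = Ideal.span {p} ∧ dy p ∉ P ∧
      ∀ h, ∃ c : ℕ → O2, (∀ j, c j ∈ xGerms) ∧ h - ∑ j ∈ Finset.range d, c j * Y ^ j ∈ P := by
  classical
  have hXk : ∀ k, X ^ k ∉ P := fun k h => hX (hP.mem_of_pow_mem k h)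
  have hex : ∃ d, ∃ g ∈ P, IsRegularY d g := by
    obtain ⟨k, d, u, w, hu, rfl⟩ := exists_eq_X_pow_mul hf0
    exact ⟨d, _, (hP.mem_or_mem hf).resolve_left (hXk k), u, w, hu, rfl⟩
  -- The generator is an element of `P` of least regularity order d. A nonzero remainder modulo p
  -- would give a smaller order, and `dy p` is regular of order d − 1.
  obtain ⟨p, hp, u, w, hu, hpe⟩ := Nat.find_spec hex
  set d := Nat.find hex with hd
  have hmin : ∀ d' g, g ∈ P → IsRegularY d' g → d ≤ d' := fun d' g hg hr =>
    Nat.find_min' hex ⟨g, hg, hr⟩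
  have hd0 : d ≠ 0 := by
    intro h0
    rw [h0, pow_zero, one_mul] at hpe
    refine hP.ne_top (P.eq_top_of_isUnit_mem hp ?_)
    rw [hpe]
    exact isUnit_add_of_value hu (by simp)
  refine ⟨p, d, le_antisymm (fun h hh => ?_) ((Ideal.span_singleton_le_iff_mem P).2 hp), fun hdy => ?_,
    fun h => ?_⟩
  · obtain ⟨q, c, hc, e⟩ := exists_division (d := d) (w := w) hu h
    rw [← hpe] at e
    have hR : ∑ j ∈ Finset.range d, c j * Y ^ j ∈ P := by
      have : ∑ j ∈ Finset.range d, c j * Y ^ j = h - p * q := by rw [e]; ring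
      rw [this]
      exact P.sub_mem hh (P.mul_mem_right _ hp)
    rcases sum_eq_X_pow_mul_regular d c hc with h0 | ⟨k, d', g, hlt, hreg, hg⟩
    · rw [h0, add_zero] at e
      exact Ideal.mem_span_singleton'.2 ⟨q, by rw [e]; ring⟩
    · rw [hg] at hR
      exact absurd (hmin d' g ((hP.mem_or_mem hR).resolve_left (hXk k)) hreg) (by omega)
  · obtain ⟨m, hm⟩ := Nat.exists_eq_succ_of_ne_zero hd0
    refine absurd (hmin m _ hdy ⟨(d : O2) * u + Y * dy u, dy w, ?_, ?_⟩) (by omega)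
    · refine isUnit_add_of_value (IsUnit.mul ?_ hu) (by simp)
      rw [isUnit_iff_value_ne_zero, value_natCast]
      exact_mod_cast hd0
    · rw [hpe, dy_add, dy_mul, dy_mul, dy_pow, dy_X, dy_Y, hm]
      simp only [Nat.succ_eq_add_one, Nat.add_sub_cancel]
      ring
  · obtain ⟨q, c, hc, e⟩ := exists_division (d := d) (w := w) hu h
    rw [← hpe] at e
    refine ⟨c, hc, ?_⟩
    have : h - ∑ j ∈ Finset.range d, c j * Y ^ j = p * q := by rw [e]; ring
    rw [this]
    exact P.mul_mem_right _ hp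

/-- A prime that contains x but not y is generated by x: modulo x, an element not divisible by x is
a power of y times a unit. For such a prime, the smooth germ x would be a component of `f`. -/
theorem X_dvd_of_mem {P : Ideal O2} (hP : P.IsPrime) (hY : Y ∉ P) (hX : X ∈ P)
    {h : O2} (hh : h ∈ P) : X ∣ h := by
  by_cases h0 : h = 0
  · rw [h0]; exact dvd_zero _
  obtain ⟨k, d, u, w, hu, rfl⟩ := exists_eq_X_pow_mul h0
  rcases k with - | k
  · rw [pow_zero, one_mul] at hh
    have h1 : Y ^ d * u ∈ P := (P.add_mem_iff_left (P.mul_mem_right _ hX)).1 hh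
    rcases hP.mem_or_mem h1 with h2 | h2
    · exact absurd (hP.mem_of_pow_mem d h2) hY
    · exact absurd (P.eq_top_of_isUnit_mem h2 hu) hP.ne_top
  · exact ⟨X ^ k * (Y ^ d * u + X * w), by ring⟩

theorem irreducible_X : Irreducible X := by
  refine ⟨fun h => isUnit_iff_value_ne_zero.1 h value_X, fun a b h => ?_⟩
  by_contra! hab
  simp only [isUnit_iff_value_ne_zero, not_not] at hab
  have := congrArg (fun g => value (dx g)) h
  simp [hab.1, hab.2] at this

theorem isSubmersion_X : IsSubmersion X := Or.inl (by simp)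

/-- Locality replaces cancellation: if p = p c b with b(0) = 0, then 1 − c b is a unit that kills p.
-/
theorem irreducible_of_isPrime_span {p : O2} (hP : (Ideal.span {p}).IsPrime) (hp : p ≠ 0) :
    Irreducible p := by
  rw [Ideal.span_singleton_prime hp] at hP
  refine ⟨hP.not_isUnit, fun a b h => ?_⟩
  have key : ∀ a b : O2, p = a * b → p ∣ a → IsUnit b := by
    rintro a b h ⟨c, rfl⟩
    by_contra hb
    have hb0 : value b = 0 := by simpa [isUnit_iff_value_ne_zero] using hb
    have hu : IsUnit (1 - c * b) := by
      rw [isUnit_iff_value_ne_zero]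
      simp [hb0]
    have h1 : p * (1 - c * b) = 0 := by
      rw [mul_sub, mul_one, sub_eq_zero]
      rw [← mul_assoc]; exact h
    exact hp ((hu.mul_left_eq_zero).1 h1)
  rcases hP.dvd_or_dvd (dvd_of_eq h) with h1 | h1
  · exact Or.inr (key a b h h1)
  · exact Or.inl (key b a (by rw [h, mul_comm]) h1)

/-- Prime ideals containing a squarefree germ without smooth components. -/
theorem exists_component {f : O2} (hf0 : f ≠ 0) (hns : NoSmoothComponents f) {P : Ideal O2}
    (hP : P.IsPrime) (hfP : f ∈ P) (hXY : X ∉ P ∨ Y ∉ P) :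
    X ∉ P ∧ (∀ q ∈ P, ¬ IsSubmersion q) ∧
    ∃ (p : O2) (d : ℕ), P = Ideal.span {p} ∧ p ∣ f ∧ dy p ∉ P ∧
      ∀ h, ∃ c : ℕ → O2, (∀ j, c j ∈ xGerms) ∧ h - ∑ j ∈ Finset.range d, c j * Y ^ j ∈ P := by
  have hX : X ∉ P := fun hX => hns X irreducible_X
    (X_dvd_of_mem hP (hXY.resolve_left fun h => h hX) hX hfP) isSubmersion_X
  obtain ⟨p, d, rfl, hp, hgen⟩ := exists_generator hP hX hfP hf0
  have hpf : p ∣ f := Ideal.mem_span_singleton.1 hfP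
  have hp0 : p ≠ 0 := fun h => hf0 (zero_dvd_iff.1 (h ▸ hpf))
  have hirr := irreducible_of_isPrime_span hP hp0
  refine ⟨hX, fun q hq hs => ?_, p, d, rfl, hpf, hp, hgen⟩
  obtain ⟨t, rfl⟩ := Ideal.mem_span_singleton.1 hq
  have hv : value p = 0 := value_eq_zero_of_mem hP.ne_top (Ideal.mem_span_singleton_self p)
  refine hns p hirr hpf ?_
  rcases hs with hs | hs
  · left; rw [dx_mul, value_add, value_mul, value_mul, hv, zero_mul, zero_add] at hs
    exact right_ne_zero_of_mul hs
  · right; rw [dy_mul, value_add, value_mul, value_mul, hv, zero_mul, zero_add] at hs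
    exact right_ne_zero_of_mul hs

/-! ### Constants of a derivation along a component -/

theorem xGerms_mul_eq_zero {a b : O2} (ha : a ∈ xGerms) (hb : b ∈ xGerms) (h : a * b = 0) :
    a = 0 ∨ b = 0 := by
  obtain ⟨a, ha, rfl⟩ := ha
  obtain ⟨b, hb, rfl⟩ := hb
  rw [ofFun_mul, zero_eq_ofFun, ofFun_eq_iff] at h
  have h1 := analyticOrderAt_eq_top.2
    (eventually_of_eventually_fst (p := fun x => (a * b) x = 0) h)
  rw [analyticOrderAt_mul ha hb] at h1
  rw [zero_eq_ofFun, ofFun_eq_iff, ofFun_eq_iff]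
  rcases ENat.add_eq_top.1 h1 with h2 | h2
  · exact Or.inl (eventually_fst (analyticOrderAt_eq_top.1 h2))
  · exact Or.inr (eventually_fst (analyticOrderAt_eq_top.1 h2))

/-- In one variable one of c, e divides the other, and the vanishing Wronskian says that the
quotient has derivative zero. -/
theorem eq_algebraMap_mul_of_wronskian {c e : O2} (hc : c ∈ xGerms) (he : e ∈ xGerms) (he0 : e ≠ 0)
    (h : e * dx c = dx e * c) : ∃ γ : ℂ, c = algebraMap ℂ O2 γ * e := by
  have key : ∀ {c e g : O2}, e ∈ xGerms → g ∈ xGerms → e ≠ 0 → c = e * g →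
      e * dx c = dx e * c → g = algebraMap ℂ O2 (value g) := by
    rintro c e g he hg he0 rfl h
    rw [dx_mul] at h
    have h1 : e * (e * dx g) = 0 := by linear_combination h
    refine eq_algebraMap_of_dx_eq_zero hg ?_
    have h2 := (xGerms_mul_eq_zero he (xGerms.mul_mem he (dx_mem hg)) h1).resolve_left he0
    exact (xGerms_mul_eq_zero he (dx_mem hg) h2).resolve_left he0
  by_cases hc0 : c = 0
  · exact ⟨0, by simp [hc0]⟩
  obtain ⟨k, v, v', hv, hv', hvv, rfl⟩ := exists_eq_X_pow_mul_unit hc hc0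
  obtain ⟨l, w, w', hw, hw', hww, rfl⟩ := exists_eq_X_pow_mul_unit he he0
  rcases le_total l k with hlk | hlk
  · obtain ⟨m, rfl⟩ := Nat.exists_eq_add_of_le hlk
    have hg : X ^ m * v * w' ∈ xGerms :=
      xGerms.mul_mem (xGerms.mul_mem (xGerms.pow_mem X_mem_xGerms _) hv) hw'
    have e1 : X ^ (l + m) * v = X ^ l * w * (X ^ m * v * w') := by
      linear_combination (-(X ^ (l + m) * v)) * hww
    refine ⟨value (X ^ m * v * w'), ?_⟩
    rw [← key he hg he0 e1 h, e1]
    ring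
  · obtain ⟨m, rfl⟩ := Nat.exists_eq_add_of_le hlk
    have hg : X ^ m * w * v' ∈ xGerms :=
      xGerms.mul_mem (xGerms.mul_mem (xGerms.pow_mem X_mem_xGerms _) hw) hv'
    have e1 : X ^ (k + m) * w = X ^ k * v * (X ^ m * w * v') := by
      linear_combination (-(X ^ (k + m) * w)) * hvv
    have e2 := key hc hg hc0 e1 (by linear_combination -h)
    set γ := value (X ^ m * w * v')
    rw [e2] at e1
    have hγ : γ ≠ 0 := by
      intro h0
      rw [h0] at e1
      exact he0 (by rw [e1]; simp)
    refine ⟨γ⁻¹, ?_⟩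
    rw [e1]
    have : algebraMap ℂ O2 γ⁻¹ * algebraMap ℂ O2 γ = 1 := by
      rw [← map_mul, inv_mul_cancel₀ hγ, map_one]
    linear_combination (-(X ^ k * v)) * this

/-- In a module spanned by d elements, any d + 1 elements are linearly dependent. -/
theorem exists_linear_relation {R A : Type*} [CommRing R] [Nontrivial R] [CommRing A] (φ : R →+* A)
    {d : ℕ} (w v : ℕ → A) (hw : ∀ t, ∃ c : ℕ → R, t = ∑ j ∈ Finset.range d, φ (c j) * w j) :
    ∃ g : ℕ → R, (∃ i ≤ d, g i ≠ 0) ∧ ∑ i ∈ Finset.range (d + 1), φ (g i) * v i = 0 := by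
  classical
  let _ : Algebra R A := φ.toAlgebra
  let v' : Fin (d + 1) → A := fun i => v i
  let S : Finset A := (Finset.range d).image w
  have hspan : Submodule.span R (S : Set A) = ⊤ := by
    refine eq_top_iff.2 fun t _ => ?_
    obtain ⟨c, rfl⟩ := hw t
    refine Submodule.sum_mem _ fun j hj => ?_
    exact Submodule.smul_mem _ (c j)
      (Submodule.subset_span (Finset.mem_coe.2 (Finset.mem_image_of_mem w hj)))
  have hdep : ¬ LinearIndependent R v' := fun hli => by
    have h1 := linearIndependent_le_span v' hli (S : Set A) hspan
    rw [Cardinal.mk_fin] at h1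
    have h2 : d + 1 ≤ S.card := by
      have : (d + 1 : ℕ) ≤ Fintype.card (S : Set A) := by exact_mod_cast h1
      rwa [← Set.toFinset_card, Finset.toFinset_coe] at this
    have h3 : S.card ≤ d := Finset.card_image_le.trans (by rw [Finset.card_range])
    omega
  obtain ⟨g, hg, i, hi⟩ := Fintype.not_linearIndependent_iff.1 hdep
  refine ⟨fun i => if h : i < d + 1 then g ⟨i, h⟩ else 0, ⟨i, by omega, by
    have := i.2
    simp only [this, dif_pos]
    exact hi⟩, ?_⟩
  rw [Finset.sum_range, ← hg]
  refine Finset.sum_congr rfl fun j _ => ?_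
  simp only [j.2, dif_pos]
  rfl

/-- If `O2 / P` is generated by `d` elements over the germs in `x`, then the monomials of degree `d`
in `a` and `b` satisfy a nontrivial linear relation modulo `P`. -/
theorem exists_relation {P : Ideal O2} {d : ℕ}
    (hgen : ∀ h, ∃ c : ℕ → O2, (∀ j, c j ∈ xGerms) ∧
      h - ∑ j ∈ Finset.range d, c j * Y ^ j ∈ P) (a b : O2) :
    ∃ c : ℕ → O2, (∀ i, c i ∈ xGerms) ∧ (∃ i ≤ d, c i ≠ 0) ∧
      ∑ i ∈ Finset.range (d + 1), c i * (a ^ i * b ^ (d - i)) ∈ P := by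
  let φ : xGerms →+* O2 ⧸ P := (Ideal.Quotient.mk P).comp (xGerms.val : xGerms →+* O2)
  obtain ⟨g, ⟨i, hi, hgi⟩, hg⟩ := exists_linear_relation (R := xGerms) (A := O2 ⧸ P) φ (d := d)
    (fun j => Ideal.Quotient.mk P (Y ^ j)) (fun i => Ideal.Quotient.mk P (a ^ i * b ^ (d - i)))
    (fun t => by
      obtain ⟨h, rfl⟩ := Ideal.Quotient.mk_surjective t
      obtain ⟨c, hc, hh⟩ := hgen h
      refine ⟨fun j => ⟨c j, hc j⟩, ?_⟩
      rw [Ideal.Quotient.eq.2 hh, map_sum]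
      exact Finset.sum_congr rfl fun j _ => map_mul _ _ _)
  refine ⟨fun i => g i, fun i => (g i).2, ⟨i, hi, fun h => hgi (Subtype.ext h)⟩, ?_⟩
  rw [← Ideal.Quotient.eq_zero_iff_mem, map_sum, ← hg]
  exact Finset.sum_congr rfl fun j _ => map_mul _ _ _

/-- A homogeneous relation with constant coefficients splits. -/
theorem exists_eq_mul_of_homogeneous {k A : Type*} [Field k] [IsAlgClosed k] [CommRing A]
    [IsDomain A] (ψ : k →+* A) {a b : A} (hb : b ≠ 0) {n : ℕ} {γ : ℕ → k} (hγ : γ n ≠ 0)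
    (h : ∑ i ∈ Finset.range (n + 1), ψ (γ i) * (a ^ i * b ^ (n - i)) = 0) :
    ∃ r : k, a = ψ r * b := by
  let K := FractionRing A
  let π : A →+* K := algebraMap A K
  have hinj : Function.Injective π := IsFractionRing.injective A K
  have hπb : π b ≠ 0 := fun h0 => hb ((map_eq_zero_iff π hinj).1 h0)
  let φ : k →+* K := π.comp ψ
  -- Dehomogenised, the relation says that a/b is a root of Q in the fraction field. Q is nonzero
  -- and splits over k, so the root comes from k.
  let Q : Polynomial k := ∑ i ∈ Finset.range (n + 1), Polynomial.monomial i (γ i)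
  have hQ : Q ≠ 0 := fun h0 => hγ (by
    have := congrArg (fun q => Polynomial.coeff q n) h0
    simpa [Q, Polynomial.coeff_monomial] using this)
  have hroot : Polynomial.eval₂ φ (π a / π b) Q = 0 := by
    rw [Polynomial.eval₂_finsetSum]
    have h2 : π b ^ n * ∑ i ∈ Finset.range (n + 1),
        Polynomial.eval₂ φ (π a / π b) (Polynomial.monomial i (γ i)) = 0 := by
      rw [← map_zero π, ← h, map_sum, Finset.mul_sum]
      refine Finset.sum_congr rfl fun i hi => ?_
      obtain ⟨m, rfl⟩ := Nat.exists_eq_add_of_le (Nat.lt_succ_iff.1 (Finset.mem_range.1 hi))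
      rw [Polynomial.eval₂_monomial, Nat.add_sub_cancel_left, map_mul, map_mul, map_pow, map_pow,
        pow_add, div_pow]
      change _ = φ (γ i) * _
      have hbi : π b ^ i ≠ 0 := pow_ne_zero _ hπb
      rw [mul_left_comm, mul_right_comm, mul_div_cancel₀ _ hbi]
    exact (mul_eq_zero.1 h2).resolve_left (pow_ne_zero _ hπb)
  have hr : (Q.map φ).IsRoot (π a / π b) := by
    rw [Polynomial.IsRoot, Polynomial.eval_map, hroot]
  obtain ⟨r, hr⟩ := (IsAlgClosed.splits Q).mem_range_of_isRoot hQ hr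
  refine ⟨r, hinj ?_⟩
  rw [map_mul]
  change _ = φ r * _
  rw [hr, div_mul_cancel₀ _ hπb]

theorem exists_sub_mul_mem {P : Ideal O2} (hP : P.IsPrime) {a b : O2} (hb : b ∉ P) {n : ℕ}
    {γ : ℕ → ℂ} (hγ : γ n ≠ 0)
    (h : ∑ i ∈ Finset.range (n + 1), algebraMap ℂ O2 (γ i) * (a ^ i * b ^ (n - i)) ∈ P) :
    ∃ r : ℂ, a - algebraMap ℂ O2 r * b ∈ P := by
  obtain ⟨r, hr⟩ := exists_eq_mul_of_homogeneous
    ((Ideal.Quotient.mk P).comp (algebraMap ℂ O2)) (a := Ideal.Quotient.mk P a)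
    (b := Ideal.Quotient.mk P b) (fun h => hb (Ideal.Quotient.eq_zero_iff_mem.1 h)) hγ (by
      rw [← Ideal.Quotient.eq_zero_iff_mem, map_sum] at h
      rw [← h]
      refine Finset.sum_congr rfl fun i _ => ?_
      simp only [map_mul, map_pow, RingHom.comp_apply])
  exact ⟨r, Ideal.Quotient.eq.1 (by rw [hr, map_mul]; rfl)⟩

/-- The constants of a derivation of `Frac (O2 / P)` are the complex numbers. -/
theorem exists_const {P : Ideal O2} (hP : P.IsPrime) (hX : X ∉ P) {d : ℕ}
    (hgen : ∀ h, ∃ c : ℕ → O2, (∀ j, c j ∈ xGerms) ∧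
      h - ∑ j ∈ Finset.range d, c j * Y ^ j ∈ P)
    (D : Derivation ℂ O2 O2) (hD : ∀ h ∈ P, D h ∈ P) (hDX : D X ∉ P)
    (hDc : ∀ c ∈ xGerms, D c = D X * dx c) {a b : O2} (hb : b ∉ P)
    (hab : b * D a - a * D b ∈ P) : ∃ γ : ℂ, a - algebraMap ℂ O2 γ * b ∈ P := by
  classical
  -- Take a homogeneous relation between a and b of least degree n, with coefficients in x. The aim
  -- is to make its coefficients constant.
  have hex : ∃ n, ∃ c : ℕ → O2, (∀ i, c i ∈ xGerms) ∧ (∃ i ≤ n, c i ≠ 0) ∧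
      ∑ i ∈ Finset.range (n + 1), c i * (a ^ i * b ^ (n - i)) ∈ P :=
    ⟨d, exists_relation hgen a b⟩
  obtain ⟨c, hc, hc0, hrel⟩ := Nat.find_spec hex
  set n := Nat.find hex with hn
  have hxP : ∀ h ∈ xGerms, h ∈ P → h = 0 := by
    intro h hh hhP
    by_contra h0
    obtain ⟨k, v, v', -, -, hvv, rfl⟩ := exists_eq_X_pow_mul_unit hh h0
    rcases hP.mem_or_mem hhP with h1 | h1
    · exact hX (hP.mem_of_pow_mem k h1)
    · exact hP.ne_top (P.eq_top_of_isUnit_mem h1 (IsUnit.of_mul_eq_one v' hvv))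
  -- A relation without top coefficient is divisible by b ∉ P. Dividing by b would lower the degree,
  -- so all its coefficients vanish.
  have hmin : ∀ c : ℕ → O2, (∀ i, c i ∈ xGerms) → c n = 0 →
      ∑ i ∈ Finset.range (n + 1), c i * (a ^ i * b ^ (n - i)) ∈ P → ∀ i ≤ n, c i = 0 := by
    intro c hc hcn hr
    by_contra! hne
    obtain ⟨i, hin, hi⟩ := hne
    obtain ⟨m, hm⟩ : ∃ m, n = m + 1 := Nat.exists_eq_succ_of_ne_zero (by
      rintro h0
      rw [h0] at hin hcn
      rw [Nat.le_zero.1 hin] at hi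
      exact hi hcn)
    have him : i ≤ m := by
      rcases Nat.lt_or_ge m i with h | h
      · exact absurd hcn (by rwa [show n = i by omega])
      · exact h
    rw [Finset.sum_range_succ, hcn, zero_mul, add_zero, hm] at hr
    have h1 : ∑ j ∈ Finset.range (m + 1), c j * (a ^ j * b ^ (m + 1 - j)) =
        b * ∑ j ∈ Finset.range (m + 1), c j * (a ^ j * b ^ (m - j)) := by
      rw [Finset.mul_sum]
      refine Finset.sum_congr rfl fun j hj => ?_
      rw [Nat.succ_sub (Nat.lt_succ_iff.1 (Finset.mem_range.1 hj)), pow_succ]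
      ring
    rw [h1] at hr
    have := Nat.find_min' hex ⟨c, hc, ⟨i, him, hi⟩, (hP.mem_or_mem hr).resolve_left hb⟩
    omega
  have hcn : c n ≠ 0 := fun h0 => by
    obtain ⟨i, hi, hci⟩ := hc0
    exact hci (hmin c hc h0 hrel i hi)
  -- logarithmic derivatives of monomials
  have hmul : ∀ {m m' : O2} {k k' : ℕ}, b * D m - k * m * D b ∈ P → b * D m' - k' * m' * D b ∈ P →
      b * D (m * m') - (k + k' : ℕ) * (m * m') * D b ∈ P := by
    intro m m' k k' h1 h2
    have : b * D (m * m') - (k + k' : ℕ) * (m * m') * D b =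
        m' * (b * D m - k * m * D b) + m * (b * D m' - k' * m' * D b) := by
      rw [D.leibniz]
      push_cast
      simp only [smul_eq_mul]
      ring
    rw [this]
    exact P.add_mem (P.mul_mem_left _ h1) (P.mul_mem_left _ h2)
  have hpow : ∀ {m : O2}, b * D m - (1 : ℕ) * m * D b ∈ P →
      ∀ i : ℕ, b * D (m ^ i) - i * m ^ i * D b ∈ P := by
    intro m h1 i
    induction i with
    | zero => simp
    | succ i ih => rw [pow_succ]; exact hmul ih h1
  have hmono : ∀ i ≤ n, b * D (a ^ i * b ^ (n - i)) - n * (a ^ i * b ^ (n - i)) * D b ∈ P := by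
    intro i hi
    have := hmul (hpow (m := a) (by simpa using hab) i) (hpow (m := b) (by simp [mul_comm]) (n - i))
    rwa [Nat.add_sub_cancel' hi] at this
  -- As D(a/b) = 0, applying D to the relation differentiates only its coefficients, apart from a
  -- multiple of the relation itself.
  have hder : ∑ i ∈ Finset.range (n + 1), dx (c i) * (a ^ i * b ^ (n - i)) ∈ P := by
    have h1 : b * D (∑ i ∈ Finset.range (n + 1), c i * (a ^ i * b ^ (n - i))) -
        n * D b * ∑ i ∈ Finset.range (n + 1), c i * (a ^ i * b ^ (n - i)) =
        b * (D X * ∑ i ∈ Finset.range (n + 1), dx (c i) * (a ^ i * b ^ (n - i))) +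
        ∑ i ∈ Finset.range (n + 1), c i *
          (b * D (a ^ i * b ^ (n - i)) - n * (a ^ i * b ^ (n - i)) * D b) := by
      rw [map_sum]
      simp only [Finset.mul_sum]
      rw [← Finset.sum_sub_distrib, ← Finset.sum_add_distrib]
      refine Finset.sum_congr rfl fun i _ => ?_
      rw [D.leibniz, hDc _ (hc i), smul_eq_mul, smul_eq_mul]
      ring
    have h2 := P.sub_mem (P.mul_mem_left b (hD _ hrel)) (P.mul_mem_left (n * D b) hrel)
    rw [h1] at h2
    have h3 : ∑ i ∈ Finset.range (n + 1), c i *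
        (b * D (a ^ i * b ^ (n - i)) - n * (a ^ i * b ^ (n - i)) * D b) ∈ P :=
      P.sum_mem fun i hi =>
        P.mul_mem_left _ (hmono i (Nat.lt_succ_iff.1 (Finset.mem_range.1 hi)))
    have h4 := (P.add_mem_iff_left h3).1 h2
    exact (hP.mem_or_mem ((hP.mem_or_mem h4).resolve_left hb)).resolve_left hDX
  -- Eliminating the top coefficient between the relation and its derivative gives, by minimality,
  -- vanishing Wronskians. Hence all coefficients are constant multiples of c n.
  have hW : ∀ i ≤ n, c n * dx (c i) = dx (c n) * c i := by
    intro i hi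
    refine sub_eq_zero.1 (hmin (fun i => c n * dx (c i) - dx (c n) * c i) (fun i => ?_)
      (by ring) ?_ i hi)
    · exact xGerms.sub_mem (xGerms.mul_mem (hc n) (dx_mem (hc i)))
        (xGerms.mul_mem (dx_mem (hc n)) (hc i))
    · have := P.sub_mem (P.mul_mem_left (c n) hder) (P.mul_mem_left (dx (c n)) hrel)
      rw [Finset.mul_sum, Finset.mul_sum, ← Finset.sum_sub_distrib] at this
      convert this using 2 with i _
      ring
  have hγ : ∀ i, ∃ γ : ℂ, i ≤ n → c i = algebraMap ℂ O2 γ * c n := by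
    intro i
    by_cases hi : i ≤ n
    · obtain ⟨γ, h⟩ := eq_algebraMap_mul_of_wronskian (hc i) (hc n) hcn (hW i hi)
      exact ⟨γ, fun _ => h⟩
    · exact ⟨0, fun h => absurd h hi⟩
  choose γ hγ using hγ
  refine exists_sub_mul_mem hP hb (n := n) (γ := γ) (fun h0 => hcn ?_) ?_
  · rw [hγ n le_rfl, h0, map_zero, zero_mul]
  · have h1 : ∑ i ∈ Finset.range (n + 1), c i * (a ^ i * b ^ (n - i)) =
        c n * ∑ i ∈ Finset.range (n + 1), algebraMap ℂ O2 (γ i) * (a ^ i * b ^ (n - i)) := by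
      rw [Finset.mul_sum]
      refine Finset.sum_congr rfl fun i hi => ?_
      rw [hγ i (Nat.lt_succ_iff.1 (Finset.mem_range.1 hi))]
      ring
    rw [h1] at hrel
    exact (hP.mem_or_mem hrel).resolve_left fun h => hcn (hxP _ (hc n) h)

/-! ### The Hamiltonian derivation; inflections and vertices -/

/-- The Hamiltonian derivation of `f`. -/
def ham (f : O2) : Derivation ℂ O2 O2 := dy f • dirDeriv (1, 0) - dx f • dirDeriv (0, 1)

theorem ham_apply (f g : O2) : ham f g = dy f * dx g - dx f * dy g := rfl

theorem ham_X (f : O2) : ham f X = dy f := by simp [ham_apply]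
theorem ham_Y (f : O2) : ham f Y = -dx f := by simp [ham_apply]

theorem ham_of_mem (f : O2) {c : O2} (hc : c ∈ xGerms) : ham f c = ham f X * dx c := by
  rw [ham_X, ham_apply, dy_eq_zero_of_mem hc, mul_zero, sub_zero]

theorem ham_mem {f p : O2} (hp : p ∣ f) {h : O2} (hh : h ∈ Ideal.span {p}) :
    ham f h ∈ Ideal.span {p} := by
  obtain ⟨g, rfl⟩ := hp
  obtain ⟨t, rfl⟩ := Ideal.mem_span_singleton.1 hh
  refine Ideal.mem_span_singleton.2
    ⟨ham (p * g) t + t * (dy g * dx p - dx g * dy p), ?_⟩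
  simp only [ham_apply, dx_mul, dy_mul]
  ring

/-- A prime factor of a squarefree germ does not divide its cofactor. -/
theorem cofactor_notMem {f p : O2} (hred : Squarefree f)
    (hP : (Ideal.span {p}).IsPrime) {g : O2} (hf : f = p * g) : g ∉ Ideal.span {p} := by
  intro hg
  obtain ⟨t, rfl⟩ := Ideal.mem_span_singleton.1 hg
  exact hP.ne_top (Ideal.span_singleton_eq_top.2 (hred p ⟨t, by rw [hf]; ring⟩))

theorem dy_notMem {f p : O2} (hred : Squarefree f) (hP : (Ideal.span {p}).IsPrime) (hpf : p ∣ f)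
    (hp : dy p ∉ Ideal.span {p}) : dy f ∉ Ideal.span {p} := by
  obtain ⟨g, hg⟩ := hpf
  intro h
  rw [hg, dy_mul] at h
  have h1 := ((Ideal.span {p}).add_mem_iff_right
    (Ideal.mul_mem_right _ _ (Ideal.mem_span_singleton_self p))).1 h
  exact (hP.mem_or_mem h1).elim (cofactor_notMem hred hP hg) hp

/-- The hypotheses under which differential equations along a component are studied. -/
structure ComponentData (f : O2) (P : Ideal O2) : Prop where
  prime : P.IsPrime
  not_submersion : ∀ q ∈ P, ¬ IsSubmersion q
  dy_notMem : dy f ∉ P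
  ham_const : ∀ {a b : O2}, b ∉ P → b * ham f a - a * ham f b ∈ P →
    ∃ γ : ℂ, a - algebraMap ℂ O2 γ * b ∈ P

theorem componentData {f : O2} (hred : Squarefree f) (hns : NoSmoothComponents f) {P : Ideal O2}
    (hP : P.IsPrime) (hfP : f ∈ P) (hXY : X ∉ P ∨ Y ∉ P) : ComponentData f P := by
  obtain ⟨hX, hsub, p, d, rfl, hpf, hp, hgen⟩ := exists_component hred.ne_zero hns hP hfP hXY
  have hdy := dy_notMem hred hP hpf hp
  exact ⟨hP, hsub, hdy, exists_const hP hX hgen (ham f) (fun h hh => ham_mem hpf hh)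
    (by rwa [ham_X]) fun c hc => ham_of_mem f hc⟩

namespace ComponentData

variable {f : O2} {P : Ideal O2}

theorem one_notMem (H : ComponentData f P) : (1 : O2) ∉ P :=
  fun h => H.prime.ne_top (P.eq_top_iff_one.2 h)

/-- The tangent direction of a non-smooth component is not constant. -/
theorem direction_notMem (H : ComponentData f P) (γ : ℂ) :
    ham f Y - algebraMap ℂ O2 γ * ham f X ∉ P := by
  intro h
  -- Y − γX has derivative zero along the component, so it equals a constant δ there. The line Y −
  -- γX − δ then lies in `P` although its y-derivative is 1.
  obtain ⟨δ, hδ⟩ := H.ham_const (a := Y - algebraMap ℂ O2 γ * X) (b := 1) H.one_notMem (by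
    simpa using h)
  exact H.not_submersion _ hδ (Or.inr (by simp))

theorem inflectionGerm_eq (f : O2) : inflectionGerm f =
    -(ham f X * ham f (ham f Y) - ham f Y * ham f (ham f X)) := by
  simp only [inflectionGerm, ham_X, ham_Y]
  simp only [ham_apply, dx_neg, dy_neg, dx_dy]
  ring

/-- With velocity (U, V), S = U² + V² and W = UV' − VU', the curvature is W/S^(3/2). The right-hand
side is SW' − (3/2)S'W, the numerator of its derivative. -/
theorem vertexGerm_eq (f : O2) : vertexGerm f =
    (ham f X ^ 2 + ham f Y ^ 2) *
      (ham f X * ham f (ham f (ham f Y)) - ham f Y * ham f (ham f (ham f X)))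
    - 3 * (ham f X * ham f (ham f X) + ham f Y * ham f (ham f Y)) *
      (ham f X * ham f (ham f Y) - ham f Y * ham f (ham f X)) := by
  simp only [vertexGerm, ham_X, ham_Y]
  simp only [ham_apply, dx_neg, dy_neg, dx_sub, dy_sub, dx_mul, dy_mul, dx_dy]
  ring

/-- A vanishing Wronskian makes the slope V/U a constant γ, which `direction_notMem` excludes. -/
theorem wronskian_notMem (H : ComponentData f P) :
    ham f X * ham f (ham f Y) - ham f Y * ham f (ham f X) ∉ P := by
  intro h
  obtain ⟨γ, hγ⟩ := H.ham_const (a := ham f Y) (b := ham f X)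
    (by rw [ham_X]; exact H.dy_notMem) h
  exact H.direction_notMem γ hγ

theorem inflectionGerm_notMem (H : ComponentData f P) : inflectionGerm f ∉ P := by
  rw [inflectionGerm_eq, neg_mem_iff]
  exact H.wronskian_notMem

/-- The speed of a non-smooth component does not vanish identically. -/
theorem speed_notMem (H : ComponentData f P) : ham f X ^ 2 + ham f Y ^ 2 ∉ P := by
  intro h
  have hI : algebraMap ℂ O2 Complex.I * algebraMap ℂ O2 Complex.I = -1 := by
    rw [← map_mul, Complex.I_mul_I, map_neg, map_one]
  -- Over ℂ the speed factors into two isotropic directions, each a constant direction.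
  have h1 : (ham f Y - algebraMap ℂ O2 Complex.I * ham f X) *
      (ham f Y - algebraMap ℂ O2 (-Complex.I) * ham f X) ∈ P := by
    rw [map_neg]
    convert h using 1
    linear_combination (-ham f X ^ 2) * hI
  rcases H.prime.mem_or_mem h1 with h2 | h2
  · exact H.direction_notMem _ h2
  · exact H.direction_notMem _ h2

/-- Otherwise the squared curvature and both coordinates of the centre of curvature are constants of
D, which puts the component on a circle q = 0 whose gradient does not vanish at the origin. -/
theorem vertexGerm_notMem (H : ComponentData f P) : vertexGerm f ∉ P := by
  intro hv
  rw [vertexGerm_eq] at hv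
  have hW := H.wronskian_notMem
  have hS := H.speed_notMem
  have hDX : ∀ a b : O2, ham f (a * b) = a * ham f b + b * ham f a := fun a b =>
    (ham f).leibniz a b
  set U := ham f X with hU
  set V := ham f Y with hV
  set W := U * ham f V - V * ham f U with hWdef
  set S := U ^ 2 + V ^ 2 with hSdef
  set v := S * (U * ham f (ham f V) - V * ham f (ham f U))
    - 3 * (U * ham f U + V * ham f V) * W with hvdef
  have hDS : ham f S = 2 * (U * ham f U + V * ham f V) := by
    rw [hSdef, map_add, pow_two, pow_two, hDX, hDX]; ring
  have hDW : ham f W = U * ham f (ham f V) - V * ham f (ham f U) := by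
    rw [hWdef, map_sub, hDX, hDX]; ring
  -- The curvature is squared to avoid the root of S: (W²/S³)' = 2Wv/S⁴.
  obtain ⟨c, hc⟩ := H.ham_const (a := W ^ 2) (b := S ^ 3)
    (fun h => hS (H.prime.mem_of_pow_mem _ h)) (by
      have : S ^ 3 * ham f (W ^ 2) - W ^ 2 * ham f (S ^ 3) = 2 * W * S ^ 2 * v := by
        simp only [pow_succ, pow_zero, one_mul, hDX]
        rw [hDS, hDW, hvdef]; ring
      rw [this]
      exact P.mul_mem_left _ hv)
  -- The centre of curvature is (X − VS/W, Y + US/W), and its derivative is (V, −U) times v/W².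
  obtain ⟨x₀, hx₀⟩ := H.ham_const (a := X * W - V * S) (b := W) hW (by
    have : W * ham f (X * W - V * S) - (X * W - V * S) * ham f W = V * v := by
      rw [map_sub, hDX, hDX, hDS, hDW, hvdef, ← hU, hWdef, hSdef]; ring
    rw [this]
    exact P.mul_mem_left _ hv)
  obtain ⟨y₀, hy₀⟩ := H.ham_const (a := Y * W + U * S) (b := W) hW (by
    have : W * ham f (Y * W + U * S) - (Y * W + U * S) * ham f W = -U * v := by
      rw [map_add, hDX, hDX, hDS, hDW, hvdef, ← hV, hWdef, hSdef]; ring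
    rw [this]
    exact P.mul_mem_left _ hv)
  set q := algebraMap ℂ O2 c *
    ((X - algebraMap ℂ O2 x₀) ^ 2 + (Y - algebraMap ℂ O2 y₀) ^ 2) - 1 with hq
  have hqP : q ∈ P := by
    have h1 : W ^ 2 * q ∈ P := by
      have e : W ^ 2 * q =
          algebraMap ℂ O2 c * (((X - algebraMap ℂ O2 x₀) * W + V * S) *
            (X * W - V * S - algebraMap ℂ O2 x₀ * W)
          + ((Y - algebraMap ℂ O2 y₀) * W - U * S) *
            (Y * W + U * S - algebraMap ℂ O2 y₀ * W))
          - (W ^ 2 - algebraMap ℂ O2 c * S ^ 3) := by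
        rw [hq, hSdef]; ring
      rw [e]
      exact P.sub_mem (P.mul_mem_left _ (P.add_mem (P.mul_mem_left _ hx₀) (P.mul_mem_left _ hy₀))) hc
    exact (H.prime.mem_or_mem h1).resolve_left fun h => hW (H.prime.mem_of_pow_mem _ h)
  have hval := value_eq_zero_of_mem H.prime.ne_top hqP
  have hx : value (dx q) = -2 * (c * x₀) := by
    rw [hq, pow_two, pow_two]; simp; ring
  have hy : value (dy q) = -2 * (c * y₀) := by
    rw [hq, pow_two, pow_two]; simp; ring
  refine H.not_submersion q hqP ?_
  -- The gradient of q at 0 is −2c(x₀, y₀). If it vanished, then q(0) would be −1, whereas q ∈ P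
  -- forces q(0) = 0.
  by_contra hn
  rw [IsSubmersion, not_or, not_ne_iff, not_ne_iff, hx, hy] at hn
  have h1 : c * x₀ = 0 := by linear_combination (-1 / 2) * hn.1
  have h2 : c * y₀ = 0 := by linear_combination (-1 / 2) * hn.2
  have h3 : c * (x₀ ^ 2 + y₀ ^ 2) - 1 = 0 := by
    rw [← hval, hq]; simp
  exact one_ne_zero (α := ℂ) (by linear_combination x₀ * h1 + y₀ * h2 - h3)

end ComponentData

/-! ### Finite intersection numbers -/

/-- Iterating Hadamard's lemma produces Taylor polynomials, and these span a finite-dimensional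
space. -/
theorem exists_finite_complement (n : ℕ) : ∃ V : Submodule ℂ O2, V.FG ∧
    ∀ h, ∃ v ∈ V, h - v ∈ (Ideal.span {X, Y} : Ideal O2) ^ n := by
  induction n with
  | zero => exact ⟨⊥, Submodule.fg_bot, fun h => ⟨0, Submodule.zero_mem _, by simp⟩⟩
  | succ n ih =>
    obtain ⟨V, hV, hVn⟩ := ih
    refine ⟨Submodule.span ℂ {1} ⊔ (V.map (LinearMap.mulLeft ℂ X) ⊔ V.map (LinearMap.mulLeft ℂ Y)),
      (Submodule.fg_span_singleton 1).sup ((hV.map _).sup (hV.map _)), fun h => ?_⟩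
    obtain ⟨h₁, h₂, e⟩ := exists_eq_value_add h
    obtain ⟨v₁, hv₁, hr₁⟩ := hVn h₁
    obtain ⟨v₂, hv₂, hr₂⟩ := hVn h₂
    refine ⟨value h • (1 : O2) + (X * v₁ + Y * v₂), ?_, ?_⟩
    · refine Submodule.add_mem_sup (Submodule.smul_mem _ _ (Submodule.mem_span_singleton_self 1))
        (Submodule.add_mem_sup ⟨v₁, hv₁, rfl⟩ ⟨v₂, hv₂, rfl⟩)
    · have : h - (value h • (1 : O2) + (X * v₁ + Y * v₂)) =
          X * (h₁ - v₁) + Y * (h₂ - v₂) := by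
        rw [← Algebra.algebraMap_eq_smul_one]
        linear_combination e
      rw [this, pow_succ']
      exact Ideal.add_mem _
        (Ideal.mul_mem_mul (Ideal.subset_span (by simp)) hr₁)
        (Ideal.mul_mem_mul (Ideal.subset_span (by simp)) hr₂)

theorem finite_quotient {I : Ideal O2} {n : ℕ} (h : (Ideal.span {X, Y} : Ideal O2) ^ n ≤ I) :
    Module.Finite ℂ (O2 ⧸ I) := by
  obtain ⟨V, hV, hVn⟩ := exists_finite_complement n
  refine ⟨?_⟩
  have : (⊤ : Submodule ℂ (O2 ⧸ I)) = V.map (Ideal.Quotient.mkₐ ℂ I).toLinearMap := by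
    refine (eq_top_iff.2 fun t _ => ?_).symm
    obtain ⟨t, rfl⟩ := Ideal.Quotient.mk_surjective t
    obtain ⟨v, hv, hr⟩ := hVn t
    exact ⟨v, hv, (Ideal.Quotient.eq.2 (h hr)).symm⟩
  rw [this]
  exact hV.map _

/-- If `(f, g)` is contained in no prime ideal other than the maximal one, then `m(f, g) < ∞`. -/
theorem intersectionNumber_ne_top {f g : O2}
    (h : ∀ P : Ideal O2, P.IsPrime → f ∈ P → g ∈ P → X ∈ P ∧ Y ∈ P) :
    intersectionNumber f g ≠ ⊤ := by
  -- The radical is the intersection of the primes above the ideal. A power of ⟨x, y⟩ then lies in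
  -- the ideal because ⟨x, y⟩ is finitely generated.
  have hle : (Ideal.span {X, Y} : Ideal O2) ≤ (Ideal.span {f, g}).radical := by
    rw [Ideal.radical_eq_sInf]
    refine le_sInf fun P hP => ?_
    have h1 := h P hP.2 (hP.1 (Ideal.subset_span (by simp))) (hP.1 (Ideal.subset_span (by simp)))
    rw [Ideal.span_le]
    rintro _ (rfl | rfl)
    · exact h1.1
    · exact h1.2
  obtain ⟨n, hn⟩ := Ideal.exists_pow_le_of_le_radical_of_fg hle
    (Submodule.fg_span (Set.toFinite _))
  have := finite_quotient hn
  rw [intersectionNumber, Ne, Cardinal.toENat_eq_top, not_le]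
  exact Module.rank_lt_aleph0 ℂ _

theorem inflectionNumber_ne_top {f : O2} (hred : Squarefree f) (hns : NoSmoothComponents f) :
    inflectionNumber f ≠ ⊤ := by
  refine intersectionNumber_ne_top fun P hP hf hg => ?_
  by_contra hXY
  exact (componentData hred hns hP hf (not_and_or.1 hXY)).inflectionGerm_notMem hg

theorem vertexNumber_ne_top {f : O2} (hred : Squarefree f) (hns : NoSmoothComponents f) :
    vertexNumber f ≠ ⊤ := by
  refine intersectionNumber_ne_top fun P hP hf hg => ?_
  by_contra hXY
  exact (componentData hred hns hP hf (not_and_or.1 hXY)).vertexGerm_notMem hg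

/-! ### Correcting curves and bounding contact orders -/

theorem exists_eq_add_snd_mul {h : ℂ × ℂ → ℂ} (hh : AnalyticAt ℂ h 0) :
    ∃ (c : ℂ → ℂ) (q : ℂ × ℂ → ℂ), AnalyticAt ℂ c 0 ∧ AnalyticAt ℂ q 0 ∧
      ∀ᶠ z : ℂ × ℂ in 𝓝 0, h z = c z.1 + z.2 * q z := by
  obtain ⟨q, c, hq, hc, e⟩ := weierstrass_division (u := fun _ => 1) (w := fun _ => 0)
    analyticAt_const analyticAt_const hh one_ne_zero 1
  refine ⟨c 0, q, hc 0, hq, e.mono fun z hz => ?_⟩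
  rw [hz]; simp; ring

/-- The implicit function theorem for `y U + x a = 0` with `U 0 ≠ 0`. -/
theorem exists_root {U a : ℂ × ℂ → ℂ} (hU : AnalyticAt ℂ U 0) (ha : AnalyticAt ℂ a 0)
    (hU0 : U 0 ≠ 0) : ∃ r : ℂ → ℂ, AnalyticAt ℂ r 0 ∧ r 0 = 0 ∧
      ∀ᶠ t in 𝓝 (0 : ℂ), r t * U (t, r t) + t * a (t, r t) = 0 := by
  -- Dividing y by yU + xa leaves a remainder c(x). On the graph y = c(x) the product of the divisor
  -- and q vanishes, so the graph is the root once q(0) ≠ 0 is known.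
  obtain ⟨q, c, hq, hc, e⟩ := weierstrass_division hU ha (h := Prod.snd) analyticAt_snd hU0 1
  simp only [pow_one, Finset.sum_range_one, pow_zero, mul_one] at e
  have hr0 : c 0 0 = 0 := by simpa using e.self_of_nhds.symm
  have hq0 : q 0 ≠ 0 := by
    have hline : ContinuousAt (fun w : ℂ => ((0 : ℂ), w)) 0 := by fun_prop
    have h1 : ContinuousAt (fun w : ℂ => U (0, w) * q (0, w)) 0 := by
      exact (ContinuousAt.comp_of_eq (g := U) hU.continuousAt hline rfl).mul
        (ContinuousAt.comp_of_eq (g := q) hq.continuousAt hline rfl)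
    -- On the axis x = 0 the division reads w = w U q, so U q = 1 off the origin and, by continuity,
    -- at it.
    have h2 : ∀ᶠ w in 𝓝[≠] (0 : ℂ), U (0, w) * q (0, w) = 1 := by
      have h3 := (hline.tendsto.eventually e).filter_mono (nhdsWithin_le_nhds (s := {0}ᶜ))
      filter_upwards [h3, self_mem_nhdsWithin] with w hw hw0
      simp only [zero_mul, add_zero, hr0] at hw
      have : w * (U (0, w) * q (0, w) - 1) = 0 := by linear_combination -hw
      exact sub_eq_zero.1 ((mul_eq_zero.1 this).resolve_left hw0)
    have h4 : U 0 * q 0 = 1 :=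
      tendsto_nhds_unique (h1.tendsto.mono_left nhdsWithin_le_nhds)
        (tendsto_const_nhds.congr' (h2.mono fun w hw => hw.symm))
    intro h5
    rw [h5, mul_zero] at h4
    exact zero_ne_one h4
  have hgraph : ContinuousAt (fun t : ℂ => (t, c 0 t)) 0 :=
    continuousAt_id.prodMk (hc 0).continuousAt
  have hT : Tendsto (fun t : ℂ => (t, c 0 t)) (𝓝 0) (𝓝 0) := by
    have := hgraph.tendsto
    rwa [show ((0 : ℂ), c 0 0) = 0 by rw [hr0]; rfl] at this
  refine ⟨c 0, hc 0, hr0, ?_⟩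
  filter_upwards [hT.eventually e, hT.eventually (hq.continuousAt.eventually_ne hq0)] with t h1 h2
  have h3 : (c 0 t * U (t, c 0 t) + t * a (t, c 0 t)) * q (t, c 0 t) = 0 := by
    linear_combination -h1
  exact (mul_eq_zero.1 h3).resolve_right h2

/-- Second order Taylor expansion of `F` along a curve in a fixed direction. -/
theorem exists_taylor {F : ℂ × ℂ → ℂ} (hF : AnalyticAt ℂ F 0) {α : ℂ → ℂ × ℂ}
    (hα : AnalyticAt ℂ α 0) (hα0 : α 0 = 0) (v : ℂ × ℂ) :
    ∃ Φ : ℂ × ℂ → ℂ, AnalyticAt ℂ Φ 0 ∧ ∀ᶠ z : ℂ × ℂ in 𝓝 0,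
      F (α z.1 + z.2 • v) = F (α z.1) + z.2 * fderiv ℂ F (α z.1) v + z.2 ^ 2 * Φ z := by
  have hcurve : AnalyticAt ℂ (fun z : ℂ × ℂ => α z.1 + z.2 • v) 0 :=
    (hα.comp_of_eq (f := Prod.fst) analyticAt_fst rfl).add (analyticAt_snd.smul analyticAt_const)
  have hΨ : AnalyticAt ℂ (fun z : ℂ × ℂ => F (α z.1 + z.2 • v)) 0 :=
    hF.comp_of_eq (f := fun z : ℂ × ℂ => α z.1 + z.2 • v) hcurve (by simp [hα0])
  obtain ⟨c₀, q, hc₀, hq, e₀⟩ := exists_eq_add_snd_mul hΨ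
  obtain ⟨c₁, Φ, hc₁, hΦ, e₁⟩ := exists_eq_add_snd_mul hq
  have e : ∀ᶠ z : ℂ × ℂ in 𝓝 0, F (α z.1 + z.2 • v) = c₀ z.1 + z.2 * c₁ z.1 + z.2 ^ 2 * Φ z := by
    filter_upwards [e₀, e₁] with z h0 h1
    rw [h0, h1]; ring
  have hline : Tendsto (fun t : ℂ => (t, (0 : ℂ))) (𝓝 0) (𝓝 (0 : ℂ × ℂ)) := by
    have : Continuous (fun t : ℂ => (t, (0 : ℂ))) := by fun_prop
    exact this.tendsto 0
  have h0 : ∀ᶠ t in 𝓝 (0 : ℂ), F (α t) = c₀ t := by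
    filter_upwards [hline.eventually e] with t ht
    simpa using ht
  have hαt : Tendsto α (𝓝 0) (𝓝 0) := by simpa [hα0] using hα.continuousAt.tendsto
  -- The linear coefficient is identified by differentiating both expressions along the line through
  -- α t in direction v.
  have h1 : ∀ᶠ t in 𝓝 (0 : ℂ), fderiv ℂ F (α t) v = c₁ t := by
    filter_upwards [hline.eventually e.eventually_nhds, hline.eventually hΦ.eventually_analyticAt,
      hαt.eventually hF.eventually_analyticAt] with t ht hΦt hFt
    have hl : ContinuousAt (fun w : ℂ => (t, w)) 0 := by fun_prop
    have ht' : ∀ᶠ w in 𝓝 (0 : ℂ), F (α t + w • v) = c₀ t + w * c₁ t + w ^ 2 * Φ (t, w) :=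
      hl.tendsto.eventually ht
    have d1 : HasDerivAt (fun w : ℂ => F (α t + w • v)) (fderiv ℂ F (α t) v) 0 := by
      have g1 : HasDerivAt (fun w : ℂ => α t + w • v) v 0 := by
        simpa using ((hasDerivAt_id (0 : ℂ)).smul_const v).const_add (α t)
      exact HasFDerivAt.comp_hasDerivAt_of_eq (0 : ℂ) hFt.differentiableAt.hasFDerivAt g1 (by simp)
    have d2 : HasDerivAt (fun w : ℂ => c₀ t + w * c₁ t + w ^ 2 * Φ (t, w)) (c₁ t) 0 := by
      have g2 : DifferentiableAt ℂ (fun w : ℂ => Φ (t, w)) 0 :=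
        DifferentiableAt.comp (g := Φ) (f := fun w : ℂ => (t, w)) 0 hΦt.differentiableAt
          (by fun_prop)
      have g3 := (((hasDerivAt_id (0 : ℂ)).mul_const (c₁ t)).const_add (c₀ t)).add
        (((hasDerivAt_id (0 : ℂ)).pow 2).mul g2.hasDerivAt)
      exact g3.congr_deriv (by simp)
    exact (d1.congr_of_eventuallyEq (ht'.mono fun w hw => hw.symm)).unique d2
  refine ⟨Φ, hΦ, ?_⟩
  filter_upwards [e, eventually_fst h0, eventually_fst h1] with z hz k0 k1
  rw [hz, k0, k1]

/-- If `F` vanishes to high order along `α`, compared to its derivative in the direction `v`, then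
`α` can be corrected in this direction to a curve along which `F` vanishes. -/
theorem exists_correction {F : ℂ × ℂ → ℂ} (hF : AnalyticAt ℂ F 0) {α : ℂ → ℂ × ℂ}
    (hα : AnalyticAt ℂ α 0) (hα0 : α 0 = 0) {v : ℂ × ℂ} {e : ℕ}
    (h1 : (2 * e + 1 : ℕ) ≤ analyticOrderAt (fun t => F (α t)) 0)
    (h2 : analyticOrderAt (fun t => fderiv ℂ F (α t) v) 0 = e) :
    ∃ r : ℂ → ℂ, AnalyticAt ℂ r 0 ∧ r 0 = 0 ∧ ∀ᶠ t in 𝓝 0, F (α t + (t ^ e * r t) • v) = 0 := by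
  obtain ⟨Φ, hΦ, hT⟩ := exists_taylor hF hα hα0 v
  have hFα : AnalyticAt ℂ (fun t => F (α t)) 0 := hF.comp_of_eq hα hα0
  have hFv : AnalyticAt ℂ (fun t => fderiv ℂ F (α t) v) 0 :=
    (analyticAt_fderiv_apply hF v).comp_of_eq hα hα0
  obtain ⟨a, ha, ea⟩ := (natCast_le_analyticOrderAt hFα).1 h1
  obtain ⟨b, hb, hb0, eb⟩ := hFv.analyticOrderAt_eq_natCast.1 h2
  -- Write F(α) = t^(2e+1) a and F_v(α) = t^e b. Inserting the displacement t^e r into the Taylor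
  -- expansion and dividing by t^(2e) leaves r (b + r Φ) + t a = 0, which `exists_root` solves
  -- because b(0) ≠ 0.
  have hU : AnalyticAt ℂ (fun z : ℂ × ℂ => b z.1 + z.2 * Φ (z.1, z.1 ^ e * z.2)) 0 := by
    refine (hb.comp_of_eq (f := Prod.fst) analyticAt_fst rfl).add (analyticAt_snd.mul ?_)
    exact hΦ.comp_of_eq (f := fun z : ℂ × ℂ => (z.1, z.1 ^ e * z.2))
      (analyticAt_fst.prod ((analyticAt_fst.pow e).mul analyticAt_snd)) (by simp)
  obtain ⟨r, hr, hr0, er⟩ := exists_root hU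
    (ha.comp_of_eq (f := Prod.fst) analyticAt_fst rfl) (by simpa using hb0)
  refine ⟨r, hr, hr0, ?_⟩
  have hg : Tendsto (fun t : ℂ => (t, t ^ e * r t)) (𝓝 0) (𝓝 0) := by
    have : ContinuousAt (fun t : ℂ => (t, t ^ e * r t)) 0 :=
      continuousAt_id.prodMk ((continuousAt_id.pow e).mul hr.continuousAt)
    have h := this.tendsto
    rwa [show ((0 : ℂ), (0 : ℂ) ^ e * r 0) = 0 by simp [hr0]] at h
  filter_upwards [hg.eventually hT, er, ea, eb] with t h3 h4 h5 h6
  rw [h3, h5, h6]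
  simp only [sub_zero, smul_eq_mul, Function.comp_apply] at h4 ⊢
  linear_combination (t ^ e) ^ 2 * h4

/-- Pull-back of holomorphic germs along a curve germ. -/
def compHom (β : ℂ → ℂ × ℂ) (hβ : Tendsto β (𝓝 0) (𝓝 0)) : O2 →+* Germ (𝓝 (0 : ℂ)) ℂ where
  toFun f := Germ.compTendsto (f : Germ (𝓝 (0 : ℂ × ℂ)) ℂ) β hβ
  map_one' := rfl
  map_zero' := rfl
  map_add' f g := by
    obtain ⟨F, hF, rfl⟩ := exists_ofFun f
    obtain ⟨G, hG, rfl⟩ := exists_ofFun g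
    rfl
  map_mul' f g := by
    obtain ⟨F, hF, rfl⟩ := exists_ofFun f
    obtain ⟨G, hG, rfl⟩ := exists_ofFun g
    rfl

theorem compHom_ofFun_eq_zero_iff {β : ℂ → ℂ × ℂ} {hβ : Tendsto β (𝓝 0) (𝓝 0)} {F : ℂ × ℂ → ℂ}
    {hF : AnalyticAt ℂ F 0} : compHom β hβ (ofFun F hF) = 0 ↔ ∀ᶠ t in 𝓝 0, F (β t) = 0 :=
  Germ.coe_eq

/-- Orders of vanishing along β add under multiplication. This makes the germs vanishing on an
immersed curve a prime ideal, to which `componentData` can be applied. -/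
theorem compHom_ker_isPrime {β : ℂ → ℂ × ℂ} (hβ : Tendsto β (𝓝 0) (𝓝 0)) (hβa : AnalyticAt ℂ β 0) :
    (RingHom.ker (compHom β hβ)).IsPrime := by
  have hβ0 : β 0 = 0 := tendsto_nhds_unique hβa.continuousAt.tendsto hβ
  refine ⟨RingHom.ker_ne_top _, fun {f g} h => ?_⟩
  obtain ⟨F, hF, rfl⟩ := exists_ofFun f
  obtain ⟨G, hG, rfl⟩ := exists_ofFun g
  simp only [RingHom.mem_ker, ofFun_mul, compHom_ofFun_eq_zero_iff] at h ⊢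
  have h1 : analyticOrderAt ((fun t => F (β t)) * fun t => G (β t)) 0 = ⊤ :=
    analyticOrderAt_eq_top.2 h
  have hFβ : AnalyticAt ℂ (fun t => F (β t)) 0 := hF.comp_of_eq hβa hβ0
  have hGβ : AnalyticAt ℂ (fun t => G (β t)) 0 := hG.comp_of_eq hβa hβ0
  rw [analyticOrderAt_mul hFβ hGβ, ENat.add_eq_top] at h1
  exact h1.imp analyticOrderAt_eq_top.1 analyticOrderAt_eq_top.1

theorem not_eventually_eq_zero_of_deriv_ne_zero {c : ℂ → ℂ} (h : deriv c 0 ≠ 0) :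
    ¬ ∀ᶠ t in 𝓝 0, c t = 0 := fun h0 => h (by
  have := Filter.EventuallyEq.deriv_eq (f := fun _ : ℂ => (0 : ℂ)) h0
  simpa using this)

theorem dx_ofFun_snd {c : ℂ → ℂ} (hc : AnalyticAt ℂ c 0) :
    dx (ofFun (fun z => c z.2) (hc.comp_of_eq (f := Prod.snd) analyticAt_snd rfl)) = 0 := by
  rw [dx_ofFun, zero_eq_ofFun]
  refine ofFun_eq_iff.2 ?_
  filter_upwards [(continuous_snd.tendsto (0 : ℂ × ℂ)).eventually hc.eventually_analyticAt]
    with z hz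
  have h := (hz.differentiableAt.hasDerivAt.hasFDerivAt.comp z
    (hasFDerivAt_snd (𝕜 := ℂ) (E := ℂ) (F := ℂ) (p := z)))
  change HasFDerivAt (fun z : ℂ × ℂ => c z.2) _ z at h
  rw [h.fderiv]
  simp

theorem exists_analytic_left_inverse {c : ℂ → ℂ} (hc : AnalyticAt ℂ c 0) (hc0 : c 0 = 0)
    (h : deriv c 0 ≠ 0) :
    ∃ σ : ℂ → ℂ, AnalyticAt ℂ σ 0 ∧ σ 0 = 0 ∧ ∀ᶠ t in 𝓝 0, σ (c t) = t := by
  have h1 := hc.analyticAt_localInverse h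
  have h2 := hc.hasStrictDerivAt.eventually_left_inverse h
  rw [hc0] at h1
  refine ⟨_, h1, ?_, h2⟩
  simpa [hc0] using h2.self_of_nhds

/-- A germ without smooth components vanishes along no immersed curve. -/
theorem not_eventually_eq_zero {F : ℂ × ℂ → ℂ} {hF : AnalyticAt ℂ F 0}
    (hred : Squarefree (ofFun F hF)) (hns : NoSmoothComponents (ofFun F hF))
    {β : ℂ → ℂ × ℂ} (hβ : AnalyticAt ℂ β 0) (hβ0 : β 0 = 0)
    (hd : deriv (fun t => (β t).1) 0 ≠ 0 ∨ deriv (fun t => (β t).2) 0 ≠ 0) :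
    ¬ ∀ᶠ t in 𝓝 0, F (β t) = 0 := by
  intro h0
  have hβt : Tendsto β (𝓝 0) (𝓝 0) := by simpa [hβ0] using hβ.continuousAt.tendsto
  have hP := compHom_ker_isPrime hβt hβ
  have h1 : AnalyticAt ℂ (fun t => (β t).1) 0 := analyticAt_fst.comp hβ
  have h2 : AnalyticAt ℂ (fun t => (β t).2) 0 := analyticAt_snd.comp hβ
  have hfP : ofFun F hF ∈ RingHom.ker (compHom β hβt) := compHom_ofFun_eq_zero_iff.2 h0
  have hXY : X ∉ RingHom.ker (compHom β hβt) ∨ Y ∉ RingHom.ker (compHom β hβt) :=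
    hd.imp (fun h hX => not_eventually_eq_zero_of_deriv_ne_zero h (compHom_ofFun_eq_zero_iff.1 hX))
      (fun h hY => not_eventually_eq_zero_of_deriv_ne_zero h (compHom_ofFun_eq_zero_iff.1 hY))
  have H := componentData hred hns hP hfP hXY
  rcases hd with hd | hd
  · obtain ⟨σ, hσ, hσ0, e⟩ := exists_analytic_left_inverse h1 (by rw [hβ0]; rfl) hd
    have hc : AnalyticAt ℂ (fun x => (β (σ x)).2) 0 := h2.comp_of_eq hσ hσ0
    -- Near 0 the curve is the graph of y as a function of x, so a germ with nonzero y-derivative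
    -- vanishes on it, contrary to `not_submersion`.
    have hmem : Y - ofFun (fun z => (β (σ z.1)).2)
        (hc.comp_of_eq (f := Prod.fst) analyticAt_fst rfl) ∈ RingHom.ker (compHom β hβt) := by
      rw [RingHom.mem_ker, map_sub, sub_eq_zero]
      refine Germ.coe_eq.2 ?_
      filter_upwards [e] with t ht
      simp [ht]
    refine H.not_submersion _ hmem (Or.inr ?_)
    rw [dy_sub, dy_Y, dy_eq_zero_of_mem ⟨_, hc, rfl⟩]
    simp
  · obtain ⟨σ, hσ, hσ0, e⟩ := exists_analytic_left_inverse h2 (by rw [hβ0]; rfl) hd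
    have hc : AnalyticAt ℂ (fun x => (β (σ x)).1) 0 := h1.comp_of_eq hσ hσ0
    have hmem : X - ofFun (fun z => (β (σ z.2)).1)
        (hc.comp_of_eq (f := Prod.snd) analyticAt_snd rfl) ∈ RingHom.ker (compHom β hβt) := by
      rw [RingHom.mem_ker, map_sub, sub_eq_zero]
      refine Germ.coe_eq.2 ?_
      filter_upwards [e] with t ht
      simp [ht]
    refine H.not_submersion _ hmem (Or.inl ?_)
    rw [dx_sub, dx_X, dx_ofFun_snd hc]
    simp

theorem le_order_mul_add_mul {a b F G : ℂ → ℂ} (ha : AnalyticAt ℂ a 0) (hb : AnalyticAt ℂ b 0)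
    (hF : AnalyticAt ℂ F 0) (hG : AnalyticAt ℂ G 0) {n : ℕ∞} (h1 : n ≤ analyticOrderAt F 0)
    (h2 : n ≤ analyticOrderAt G 0) : n ≤ analyticOrderAt (a * F + b * G) 0 := by
  refine le_trans (le_min ?_ ?_) le_analyticOrderAt_add
  · rw [analyticOrderAt_mul ha hF]
    exact h1.trans le_add_self
  · rw [analyticOrderAt_mul hb hG]
    exact h2.trans le_add_self

/-- The order of `F` along a curve transverse to `v` is bounded if a power of a coordinate
vanishing on `v` lies in the ideal generated by `F` and its derivative along `v`. -/
theorem order_le {F : ℂ × ℂ → ℂ} {hF : AnalyticAt ℂ F 0}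
    (hred : Squarefree (ofFun F hF)) (hns : NoSmoothComponents (ofFun F hF))
    {v : ℂ × ℂ} {ℓ : ℂ × ℂ →L[ℂ] ℂ} (hℓv : ℓ v = 0) {k : ℕ} {A B : ℂ × ℂ → ℂ}
    (hA : AnalyticAt ℂ A 0) (hB : AnalyticAt ℂ B 0)
    (hAB : ∀ᶠ z in 𝓝 0, ℓ z ^ k = A z * F z + B z * fderiv ℂ F z v)
    (hℓ : ∀ β : ℂ → ℂ × ℂ, deriv (fun t => ℓ (β t)) 0 ≠ 0 →
      deriv (fun t => (β t).1) 0 ≠ 0 ∨ deriv (fun t => (β t).2) 0 ≠ 0)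
    {α : ℂ → ℂ × ℂ} (hα : AnalyticAt ℂ α 0) (hα0 : α 0 = 0)
    (hd : deriv (fun t => ℓ (α t)) 0 ≠ 0) :
    analyticOrderAt (fun t => F (α t)) 0 ≤ (2 * k : ℕ) := by
  by_contra! hlt
  have hαt : Tendsto α (𝓝 0) (𝓝 0) := by simpa [hα0] using hα.continuousAt.tendsto
  have hFα : AnalyticAt ℂ (fun t => F (α t)) 0 := hF.comp_of_eq hα hα0
  have hFv : AnalyticAt ℂ (fun t => fderiv ℂ F (α t) v) 0 :=
    (analyticAt_fderiv_apply hF v).comp_of_eq hα hα0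
  have hAα : AnalyticAt ℂ (fun t => A (α t)) 0 := hA.comp_of_eq hα hα0
  have hBα : AnalyticAt ℂ (fun t => B (α t)) 0 := hB.comp_of_eq hα hα0
  have hℓα : AnalyticAt ℂ (fun t => ℓ (α t)) 0 := (ℓ.analyticAt _).comp hα
  have hge : ((2 * k + 1 : ℕ) : ℕ∞) ≤ analyticOrderAt (fun t => F (α t)) 0 := by
    rw [Nat.cast_add, Nat.cast_one]
    exact Order.add_one_le_of_lt hlt
  have hk : analyticOrderAt (fun t => ℓ (α t) ^ k) 0 = k := by
    have h1 : analyticOrderAt (fun t => ℓ (α t)) 0 = 1 :=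
      hℓα.analyticOrderAt_eq_one_of_zero_deriv_ne_zero (by simp [hα0]) hd
    refine (analyticOrderAt_pow hℓα k).trans ?_
    rw [h1, nsmul_one]
  -- Along α the power ℓ^k has order exactly k, so F and its derivative along v cannot both vanish
  -- to order k + 1.
  have he : analyticOrderAt (fun t => fderiv ℂ F (α t) v) 0 ≤ k := by
    by_contra! hlt'
    have h1 : ((k + 1 : ℕ) : ℕ∞) ≤ analyticOrderAt (fun t => fderiv ℂ F (α t) v) 0 := by
      rw [Nat.cast_add, Nat.cast_one]
      exact Order.add_one_le_of_lt hlt'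
    have h2 : ((k + 1 : ℕ) : ℕ∞) ≤ analyticOrderAt (fun t => F (α t)) 0 :=
      le_trans (by exact_mod_cast (by omega : k + 1 ≤ 2 * k + 1)) hge
    have h3 := le_order_mul_add_mul hAα hBα hFα hFv h2 h1
    have h4 : (fun t => ℓ (α t) ^ k) =ᶠ[𝓝 0] (fun t => A (α t)) * (fun t => F (α t)) +
        (fun t => B (α t)) * fun t => fderiv ℂ F (α t) v := hαt.eventually hAB
    rw [← analyticOrderAt_congr h4, hk] at h3
    have : k + 1 ≤ k := by exact_mod_cast h3
    omega
  obtain ⟨e, hee⟩ := ENat.ne_top_iff_exists.1 (ne_top_of_le_ne_top (ENat.natCast_ne_top k) he)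
  have hek : e ≤ k := by rw [← hee] at he; exact_mod_cast he
  obtain ⟨r, hr, hr0, hroot⟩ := exists_correction hF hα hα0
    (le_trans (by exact_mod_cast (by omega : 2 * e + 1 ≤ 2 * k + 1)) hge) hee.symm
  -- As ℓ v = 0, the correction leaves ℓ∘α unchanged, so the corrected curve is still immersed.
  refine not_eventually_eq_zero hred hns (β := fun t => α t + (t ^ e * r t) • v)
    (hα.add (((analyticAt_id.pow e).mul hr).smul analyticAt_const)) (by simp [hα0, hr0])
    (hℓ _ ?_) hroot
  simpa [hℓv] using hd

theorem exists_pow_eq {f g h : O2} (H : ∀ P : Ideal O2, P.IsPrime → f ∈ P → g ∈ P → h ∈ P) :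
    ∃ (k : ℕ) (a b : O2), h ^ k = a * f + b * g := by
  have : h ∈ (Ideal.span {f, g}).radical := by
    rw [Ideal.radical_eq_sInf]
    refine Submodule.mem_sInf.2 fun P hP => H P hP.2 (hP.1 (Ideal.subset_span (by simp)))
      (hP.1 (Ideal.subset_span (by simp)))
  obtain ⟨k, hk⟩ := this
  obtain ⟨a, b, h⟩ := Ideal.mem_span_pair.1 hk
  exact ⟨k, a, b, h.symm⟩

/-- An immersion has nonzero velocity in x or in y. It is corrected in the other coordinate
direction, which uses x^k ∈ ⟨f, f_y⟩ in the first case and y^l ∈ ⟨f, f_x⟩ in the second. -/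
theorem exists_contact_bound {f : O2} (hred : Squarefree f) (hns : NoSmoothComponents f) :
    ∃ N : ℕ, ∀ n ∈ contactSet f, n ≤ N := by
  obtain ⟨k, a, b, hk⟩ := exists_pow_eq (f := f) (g := dy f) (h := X) fun P hP hf hg => by
    by_contra hX
    exact (componentData hred hns hP hf (Or.inl hX)).dy_notMem hg
  obtain ⟨l, a', b', hl⟩ := exists_pow_eq (f := f) (g := dx f) (h := Y) fun P hP hf hg => by
    by_contra hY
    refine (componentData hred hns hP hf (Or.inr hY)).direction_notMem 0 ?_
    rw [map_zero, zero_mul, sub_zero, ham_Y]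
    exact P.neg_mem hg
  obtain ⟨F, hF, rfl⟩ := exists_ofFun f
  obtain ⟨A, hA, rfl⟩ := exists_ofFun a
  obtain ⟨B, hB, rfl⟩ := exists_ofFun b
  obtain ⟨A', hA', rfl⟩ := exists_ofFun a'
  obtain ⟨B', hB', rfl⟩ := exists_ofFun b'
  rw [dy_ofFun, X, ofFun_pow, ofFun_mul, ofFun_mul, ofFun_add, ofFun_eq_iff] at hk
  rw [dx_ofFun, Y, ofFun_pow, ofFun_mul, ofFun_mul, ofFun_add, ofFun_eq_iff] at hl
  refine ⟨2 * max k l, ?_⟩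
  rintro _ ⟨α, rfl⟩
  change analyticOrderAt (fun t => F (α.toFun t)) 0 ≤ _
  have hα := α.analyticAt
  by_cases h1 : deriv (fun t => (α.toFun t).1) 0 = 0
  · have h2 : deriv (fun t => (α.toFun t).2) 0 ≠ 0 := fun h2 => α.deriv_ne_zero (by
      have e1 := (hasFDerivAt_fst (𝕜 := ℂ) (E := ℂ) (F := ℂ)
        (p := α.toFun 0)).comp_hasDerivAt 0 hα.differentiableAt.hasDerivAt
      have e2 := (hasFDerivAt_snd (𝕜 := ℂ) (E := ℂ) (F := ℂ)
        (p := α.toFun 0)).comp_hasDerivAt 0 hα.differentiableAt.hasDerivAt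
      exact Prod.ext (e1.deriv.symm.trans h1) (e2.deriv.symm.trans h2))
    refine (order_le hred hns (v := (1, 0)) (ℓ := ContinuousLinearMap.snd ℂ ℂ ℂ) rfl hA' hB' hl
      (fun β hβ => Or.inr hβ) hα α.map_zero h2).trans ?_
    exact_mod_cast (by omega : 2 * l ≤ 2 * max k l)
  · refine (order_le hred hns (v := (0, 1)) (ℓ := ContinuousLinearMap.fst ℂ ℂ ℂ) rfl hA hB hk
      (fun β hβ => Or.inl hβ) hα α.map_zero h1).trans ?_
    exact_mod_cast (by omega : 2 * k ≤ 2 * max k l)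

theorem contactSet_finite {f : O2} (hred : Squarefree f) (hns : NoSmoothComponents f) :
    (contactSet f).Finite ∧ ⊤ ∉ contactSet f := by
  obtain ⟨N, hN⟩ := exists_contact_bound hred hns
  refine ⟨((Set.finite_Iic N).image (fun n : ℕ => (n : ℕ∞))).subset fun n hn => ?_,
    fun h => ENat.natCast_ne_top N (top_le_iff.1 (hN _ h))⟩
  obtain ⟨m, rfl⟩ := ENat.ne_top_iff_exists.1 (ne_top_of_le_ne_top (ENat.natCast_ne_top N) (hN n hn))
  exact ⟨m, by exact_mod_cast hN _ hn, rfl⟩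

end

end PlaneCurve

theorem mainTheorem10 (f : PlaneCurve.O2) (hf0 : PlaneCurve.value f = 0)
    (hred : Squarefree f) (hns : PlaneCurve.NoSmoothComponents f) :
    ((PlaneCurve.contactSet f).Finite ∧ ⊤ ∉ PlaneCurve.contactSet f) ∧
      PlaneCurve.inflectionNumber f ≠ ⊤ ∧ PlaneCurve.vertexNumber f ≠ ⊤ :=
  ⟨PlaneCurve.contactSet_finite hred hns, PlaneCurve.inflectionNumber_ne_top hred hns,
    PlaneCurve.vertexNumber_ne_top hred hns⟩
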